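/- Let $d_B$ be a natural number and let $U$ be a unitary operator on $\mathbb{C}^3\otimes\mathbb{C}^{d_B}$ of Schmidt rank $3$; that is, $U=\sum_{j=1}^{3}A_j\otimes B_j$ with linearly independent $3\times 3$ complex matrices $A_1,A_2,A_3$ and linearly independent $d_B\times d_B$ complex matrices $B_1,B_2,B_3$. Then $U$ is locally unitarily equivalent to a controlled unitary, controlled from the $A$ side or from the $B$ side: there are unitary $3\times3$ matrices $P,R$ and unitary $d_B\times d_B$ matrices $Q,S$ such that either $$U=(P\otimes Q)\Big(\sum_{j=1}^{3}|j\rangle\langle j|\otimes V_j\Big)(R\otimes S)$$ for some unitary $d_B\times d_B$ matrices $V_1,V_2,V_3$, or $$U=(P\otimes Q)\Big(\sum_{j=1}^{d_B}V_j\otimes|j\rangle\langle j|\Big)(R\otimes S)$$ for some unitary $3\times3$ matrices $V_1,\dots,V_{d_B}$, where $|j\rangle$ denotes the standard basis vectors. -/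

import Mathlib

open scoped Kronecker

namespace BipartiteUnitary

variable {a b : Type*} [Fintype a] [Fintype b] [DecidableEq a] [DecidableEq b]

/-- Two operators on `ℂ^a ⊗ ℂ^b` are locally equivalent when `U = (P ⊗ Q) V (R ⊗ S)` for some
unitaries `P, R` on `ℂ^a` and `Q, S` on `ℂ^b`. -/
def LocallyEquivalent (U V : Matrix (a × b) (a × b) ℂ) : Prop :=
  ∃ P ∈ Matrix.unitaryGroup a ℂ, ∃ Q ∈ Matrix.unitaryGroup b ℂ,
    ∃ R ∈ Matrix.unitaryGroup a ℂ, ∃ S ∈ Matrix.unitaryGroup b ℂ,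
      U = (P ⊗ₖ Q) * V * (R ⊗ₖ S)

/-- `U` has Schmidt rank `n`: it is a sum of `n` product operators whose factors are linearly
independent on each side. -/
def HasSchmidtRank (U : Matrix (a × b) (a × b) ℂ) (n : ℕ) : Prop :=
  ∃ (A : Fin n → Matrix a a ℂ) (B : Fin n → Matrix b b ℂ),
    LinearIndependent ℂ A ∧ LinearIndependent ℂ B ∧ U = ∑ j, A j ⊗ₖ B j

/-- `U` is locally equivalent to `∑ j, |j⟩⟨j| ⊗ V j` with every `V j` unitary. -/
def IsControlledFromA (U : Matrix (a × b) (a × b) ℂ) : Prop :=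
  ∃ V : a → Matrix b b ℂ, (∀ j, V j ∈ Matrix.unitaryGroup b ℂ) ∧
    LocallyEquivalent U (∑ j, Matrix.single j j (1 : ℂ) ⊗ₖ V j)

/-- `U` is locally equivalent to `∑ j, V j ⊗ |j⟩⟨j|` with every `V j` unitary. -/
def IsControlledFromB (U : Matrix (a × b) (a × b) ℂ) : Prop :=
  ∃ V : b → Matrix a a ℂ, (∀ j, V j ∈ Matrix.unitaryGroup a ℂ) ∧
    LocallyEquivalent U (∑ j, V j ⊗ₖ Matrix.single j j (1 : ℂ))

end BipartiteUnitary

open scoped ComplexOrder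

namespace BipartiteUnitary
open Matrix

/-! ### Simultaneous unitary diagonalization. -/

section Diagonalization

variable {b : Type*} [Fintype b] [DecidableEq b]

/-! Regard `U` as a 3 × 3 matrix `X` of blocks in `W = span (range B)`, of dimension at most 3. Two
properties give the two alternatives. If all products xᴴy of blocks commute (`HasCommProducts`), a
common eigenbasis of these products diagonalizes every block, and `U` is controlled from B. If
unitaries on the block indices make `X` block diagonal (`BlockDiagonalizable`), `U` is controlled
from A. Both are unaffected by such unitaries, so `X` may be normalized freely.

Two proportional columns. Unitarity reads Σ (AⱼᴴAₖ)(p,q) BⱼᴴBₖ = δ(p,q)·1. Modulo scalars this is a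
product of two matrices equal to zero, so their ranks add up to at most 9. Either the BⱼᴴBₖ lie in
the span of 1 and one further matrix, hence commute, or at least a two-dimensional space of σ
satisfies tr(σ AⱼᴴAₖ) = 0 for all j, k. That space is closed under adjoints and consists of
traceless matrices. As 3 is odd, it contains a nonzero singular Hermitian σ = t(uuᴴ − vvᴴ). Hence
the vectors Aⱼu and Aⱼv have equal Gram matrices and differ by a unitary; diagonalizing it gives X i
1 = ωᵢ X i 0 with |ωᵢ| = 1 (`hasCommProducts_or_exists_column`).

Using the proportionality. Unless some combination of columns is a product vector (`Reducible`), the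
ωᵢ are distinct, the blocks X i 0 are nonzero multiples of unitaries, and X i 2 is a multiple of X i
0 · G for one fixed G. Linear relations forced by dim W ≤ 3 then make all products commute
(`reducible_or_hasCommProducts_of_column`).

The reducible case. A product column splits off a 1 × 1 block and leaves a unitary 2 × 2 block
matrix whose four blocks satisfy a linear relation. Either it is block diagonalizable, or it can be
brought to the form [[x, y], [z, −x]]; there unitarity alone makes the products commute, and x, y, z
span the remaining block too (`Reducible.hasCommProducts_or_blockDiagonalizable`). -/

theorem mem_unitaryGroup_of_orthonormalBasis (v : OrthonormalBasis b ℂ (EuclideanSpace ℂ b)) :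
    (Matrix.of fun r s => v s r) ∈ unitaryGroup b ℂ := by
  rw [mem_unitaryGroup_iff']
  ext r s
  have h := v.inner_eq_ite r s
  rw [EuclideanSpace.inner_eq_star_dotProduct] at h
  rw [mul_apply, one_apply, ← h]
  simp [dotProduct, mul_comm]

/-- A commuting family of Hermitian matrices has a common orthonormal eigenbasis. -/
theorem exists_unitary_of_commute_hermitian {ι : Type*} (T : ι → Matrix b b ℂ)
    (hT : ∀ i, (T i).IsHermitian) (hc : ∀ i j, Commute (T i) (T j)) :
    ∃ S ∈ unitaryGroup b ℂ, ∀ i, ∃ D : b → ℂ, T i * S = S * diagonal D := by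
  classical
  let f : ι → Module.End ℂ (EuclideanSpace ℂ b) := fun i => toEuclideanLin (T i)
  have hf : ∀ i, (f i).IsSymmetric := fun i => isSymmetric_toEuclideanLin_iff.mpr (hT i)
  have hfc : Pairwise (Function.onFun Commute f) := by
    intro i j _
    refine LinearMap.ext fun x => ?_
    have := congrArg (fun M : Matrix b b ℂ => toEuclideanLin M x) (hc i j).eq
    simpa [f, toLpLin_apply, ← mulVec_mulVec] using this
  have hV := LinearMap.IsSymmetric.directSum_isInternal_of_pairwise_commute hf hfc
  have hO := LinearMap.IsSymmetric.orthogonalFamily_iInf_eigenspaces hf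
  set V : (ι → ℂ) → Submodule ℂ (EuclideanSpace ℂ b) :=
    fun χ => ⨅ j, Module.End.eigenspace (f j) (χ j) with hVdef
  -- The characters χ form an infinite type; only finitely many joint eigenspaces are nonzero, and a
  -- subordinate orthonormal basis needs a finite index.
  have hfin : Finite {χ // V χ ≠ ⊥} :=
    WellFoundedGT.finite_ne_bot_of_iSupIndep hV.submodule_iSupIndep
  have : Fintype {χ // V χ ≠ ⊥} := Fintype.ofFinite _
  have hV' := DirectSum.isInternal_ne_bot_iff.mpr hV
  have hO' : OrthogonalFamily ℂ (fun χ : {χ // V χ ≠ ⊥} => V χ) fun χ => (V χ).subtypeₗᵢ :=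
    hO.comp Subtype.val_injective
  have hn : Module.finrank ℂ (EuclideanSpace ℂ b) = Fintype.card b := finrank_euclideanSpace
  let v := (hV'.subordinateOrthonormalBasis hn hO').reindex (Fintype.equivFin b).symm
  refine ⟨_, mem_unitaryGroup_of_orthonormalBasis v, fun i => ?_⟩
  refine ⟨fun s => (hV'.subordinateOrthonormalBasisIndex hn (Fintype.equivFin b s) hO').1 i, ?_⟩
  ext r s
  have h := hV'.subordinateOrthonormalBasis_subordinate hn (Fintype.equivFin b s) hO'
  have h2 := Module.End.mem_eigenspace_iff.mp ((Submodule.mem_iInf _).mp h i)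
  have h3 := congrArg (fun x : EuclideanSpace ℂ b => x r) h2
  simp only [f, toLpLin_apply, PiLp.smul_apply, smul_eq_mul] at h3
  rw [mul_diagonal, mul_comm, mul_apply]
  simpa [v, mulVec, dotProduct] using h3

/-- A commuting family of normal matrices has a common orthonormal eigenbasis. -/
theorem exists_unitary_of_commute_normal {ι : Type*} (T : ι → Matrix b b ℂ)
    (hc : ∀ i j, Commute (T i) (T j)) (hs : ∀ i j, Commute (T i)ᴴ (T j)) :
    ∃ S ∈ unitaryGroup b ℂ, ∀ i, ∃ D : b → ℂ, T i * S = S * diagonal D := by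
  have hss : ∀ i j, Commute (T i)ᴴ (T j)ᴴ := fun i j => (hc i j).star_star
  have hs' : ∀ i j, Commute (T i) (T j)ᴴ := fun i j => (hs j i).symm
  -- Up to scaling, the real and imaginary parts of each `T i`: commuting Hermitian matrices from
  -- which `T i` is recovered linearly.
  let H : ι × Bool → Matrix b b ℂ := fun p =>
    if p.2 then T p.1 + (T p.1)ᴴ else Complex.I • (T p.1 - (T p.1)ᴴ)
  obtain ⟨S, hS, hD⟩ := exists_unitary_of_commute_hermitian H
    (by
      rintro ⟨i, c⟩
      cases c
      · simp [H, IsHermitian, conjTranspose_smul, ← smul_neg]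
      · simp [H, IsHermitian, add_comm])
    (by
      rintro ⟨i, c⟩ ⟨j, e⟩
      have h1 : ∀ X, Commute (T i) X → Commute (T i)ᴴ X → Commute (H (i, c)) X := by
        intro X hX hX'
        cases c
        · exact (hX.sub_left hX').smul_left _
        · exact hX.add_left hX'
      have h2 : ∀ X, Commute X (T j) → Commute X (T j)ᴴ → Commute X (H (j, e)) := by
        intro X hX hX'
        cases e
        · exact (hX.sub_right hX').smul_right _
        · exact hX.add_right hX'
      exact h1 _ (h2 _ (hc i j) (hs' i j)) (h2 _ (hs i j) (hss i j)))
  refine ⟨S, hS, fun i => ?_⟩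
  obtain ⟨D, hD1⟩ := hD (i, true)
  obtain ⟨E, hE1⟩ := hD (i, false)
  refine ⟨fun s => (2 : ℂ)⁻¹ * (D s - Complex.I * E s), ?_⟩
  have hT : T i = (2 : ℂ)⁻¹ • (H (i, true) - Complex.I • H (i, false)) := by
    simp only [H, if_true, smul_smul, Complex.I_mul_I, Bool.false_eq_true, if_false]
    module
  have hDE : diagonal (fun s => (2 : ℂ)⁻¹ * (D s - Complex.I * E s)) =
      (2 : ℂ)⁻¹ • (diagonal D - Complex.I • diagonal E) := by
    ext r s
    by_cases h : r = s <;> simp [diagonal, h]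
  rw [hDE, hT, smul_mul_assoc, sub_mul, smul_mul_assoc, hD1, hE1, mul_smul_comm, mul_sub,
    mul_smul_comm]

end Diagonalization

/-! ### Block matrices and the two criteria for being controlled. -/

section Blocks

set_option linter.unusedSectionVars false

variable {a b : Type*} [Fintype a] [Fintype b] [DecidableEq a] [DecidableEq b]

/-- The block matrix of `P ⊗ 1`. -/
def scalarBlocks (b : Type*) [Fintype b] [DecidableEq b] (P : Matrix a a ℂ) :
    Matrix a a (Matrix b b ℂ) :=
  P.map (algebraMap ℂ (Matrix b b ℂ))

theorem scalarBlocks_mul (P R : Matrix a a ℂ) :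
    scalarBlocks b (P * R) = scalarBlocks b P * scalarBlocks b R :=
  Matrix.map_mul

theorem scalarBlocks_one : scalarBlocks b (1 : Matrix a a ℂ) = 1 :=
  Matrix.map_one _ (map_zero _) (map_one _)

theorem star_scalarBlocks (P : Matrix a a ℂ) :
    star (scalarBlocks b P) = scalarBlocks b (star P) := by
  ext i k r s
  by_cases h : r = s
  · simp [scalarBlocks, star_apply, algebraMap_eq_diagonal, h]
  · simp [scalarBlocks, star_apply, algebraMap_eq_diagonal, h, Ne.symm h]

theorem scalarBlocks_mem_unitary {P : Matrix a a ℂ} (hP : P ∈ unitaryGroup a ℂ) :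
    scalarBlocks b P ∈ unitary (Matrix a a (Matrix b b ℂ)) := by
  constructor
  · rw [star_scalarBlocks, ← scalarBlocks_mul, mem_unitaryGroup_iff'.mp hP, scalarBlocks_one]
  · rw [star_scalarBlocks, ← scalarBlocks_mul, mem_unitaryGroup_iff.mp hP, scalarBlocks_one]

theorem comp_scalarBlocks (P : Matrix a a ℂ) :
    comp a a b b ℂ (scalarBlocks b P) = P ⊗ₖ (1 : Matrix b b ℂ) := by
  ext ⟨i, r⟩ ⟨k, s⟩
  simp [scalarBlocks, comp_apply, kroneckerMap_apply, algebraMap_eq_diagonal, one_apply,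
    diagonal_apply]

theorem scalarBlocks_mul_mul_apply (P R : Matrix a a ℂ) (X : Matrix a a (Matrix b b ℂ))
    (i k : a) :
    (scalarBlocks b P * X * scalarBlocks b R) i k = ∑ l, ∑ j, (P i j * R l k) • X j l := by
  simp only [mul_apply, scalarBlocks, map_apply, Algebra.algebraMap_eq_smul_one, smul_mul_assoc,
    mul_smul_comm, one_mul, mul_one, Finset.smul_sum, smul_smul, mul_comm (R _ _)]

theorem scalarBlocks_mul_mul_mem {P R : Matrix a a ℂ} {X : Matrix a a (Matrix b b ℂ)}
    {W : Submodule ℂ (Matrix b b ℂ)} (hX : ∀ i k, X i k ∈ W) (i k : a) :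
    (scalarBlocks b P * X * scalarBlocks b R) i k ∈ W := by
  rw [scalarBlocks_mul_mul_apply]
  exact W.sum_mem fun l _ => W.sum_mem fun j _ => W.smul_mem _ (hX j l)

theorem scalarBlocks_conj_cancel {P R : Matrix a a ℂ} (hP : P ∈ unitaryGroup a ℂ)
    (hR : R ∈ unitaryGroup a ℂ) (X : Matrix a a (Matrix b b ℂ)) :
    scalarBlocks b (star P) * (scalarBlocks b P * X * scalarBlocks b R) *
      scalarBlocks b (star R) = X := by
  have h1 : scalarBlocks b (star P) * scalarBlocks b P = 1 := by
    rw [← scalarBlocks_mul, mem_unitaryGroup_iff'.mp hP, scalarBlocks_one]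
  have h2 : scalarBlocks b R * scalarBlocks b (star R) = 1 := by
    rw [← scalarBlocks_mul, mem_unitaryGroup_iff.mp hR, scalarBlocks_one]
  calc _ = (scalarBlocks b (star P) * scalarBlocks b P) * X *
      (scalarBlocks b R * scalarBlocks b (star R)) := by simp only [mul_assoc]
    _ = X := by rw [h1, h2, one_mul, mul_one]

/-- All products `xᴴ y` of elements of `T` commute with one another. -/
def CommProducts (T : Set (Matrix b b ℂ)) : Prop :=
  ∀ x ∈ T, ∀ y ∈ T, ∀ z ∈ T, ∀ w ∈ T, Commute (xᴴ * y) (zᴴ * w)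

/-- The products are linear or conjugate-linear in each of the four arguments, which are extended
one at a time. -/
theorem CommProducts.span {T : Set (Matrix b b ℂ)} (hT : CommProducts T) :
    CommProducts (Submodule.span ℂ T : Set (Matrix b b ℂ)) := by
  have h1 : ∀ x ∈ Submodule.span ℂ T, ∀ y ∈ T, ∀ z ∈ T, ∀ w ∈ T, Commute (xᴴ * y) (zᴴ * w) := by
    intro x hx y hy z hz w hw
    induction hx using Submodule.span_induction with
    | mem x hx => exact hT x hx y hy z hz w hw
    | zero => simp
    | add p q _ _ hp hq => rw [conjTranspose_add, add_mul]; exact hp.add_left hq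
    | smul c p _ hp => rw [conjTranspose_smul, smul_mul_assoc]; exact hp.smul_left _
  have h2 : ∀ x ∈ Submodule.span ℂ T, ∀ y ∈ Submodule.span ℂ T, ∀ z ∈ T, ∀ w ∈ T,
      Commute (xᴴ * y) (zᴴ * w) := by
    intro x hx y hy z hz w hw
    induction hy using Submodule.span_induction with
    | mem y hy => exact h1 x hx y hy z hz w hw
    | zero => simp
    | add p q _ _ hp hq => rw [mul_add]; exact hp.add_left hq
    | smul c p _ hp => rw [mul_smul_comm]; exact hp.smul_left _
  have h3 : ∀ x ∈ Submodule.span ℂ T, ∀ y ∈ Submodule.span ℂ T, ∀ z ∈ Submodule.span ℂ T,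
      ∀ w ∈ T, Commute (xᴴ * y) (zᴴ * w) := by
    intro x hx y hy z hz w hw
    induction hz using Submodule.span_induction with
    | mem z hz => exact h2 x hx y hy z hz w hw
    | zero => simp
    | add p q _ _ hp hq => rw [conjTranspose_add, add_mul]; exact hp.add_right hq
    | smul c p _ hp => rw [conjTranspose_smul, smul_mul_assoc]; exact hp.smul_right _
  intro x hx y hy z hz w hw
  induction hw using Submodule.span_induction with
  | mem w hw => exact h3 x hx y hy z hz w hw
  | zero => simp
  | add p q _ _ hp hq => rw [mul_add]; exact hp.add_right hq
  | smul c p _ hp => rw [mul_smul_comm]; exact hp.smul_right _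

/-- `X` becomes block diagonal after unitary changes of the block indices. -/
def BlockDiagonalizable (X : Matrix a a (Matrix b b ℂ)) : Prop :=
  ∃ P ∈ unitaryGroup a ℂ, ∃ R ∈ unitaryGroup a ℂ,
    ∀ i k, i ≠ k → (scalarBlocks b P * X * scalarBlocks b R) i k = 0

/-- The blocks of `X` lie in a space all of whose products `xᴴ y` commute. -/
def HasCommProducts (X : Matrix a a (Matrix b b ℂ)) : Prop :=
  ∃ T : Set (Matrix b b ℂ), CommProducts T ∧ ∀ i k, X i k ∈ Submodule.span ℂ T

theorem BlockDiagonalizable.of_conj {P R : Matrix a a ℂ} (hP : P ∈ unitaryGroup a ℂ)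
    (hR : R ∈ unitaryGroup a ℂ) {X : Matrix a a (Matrix b b ℂ)}
    (h : BlockDiagonalizable (scalarBlocks b P * X * scalarBlocks b R)) :
    BlockDiagonalizable X := by
  obtain ⟨P', hP', R', hR', h⟩ := h
  refine ⟨P' * P, mul_mem hP' hP, R * R', mul_mem hR hR', fun i k hik => ?_⟩
  rw [← h i k hik]
  simp only [scalarBlocks_mul, mul_assoc]

theorem HasCommProducts.of_conj {P R : Matrix a a ℂ} (hP : P ∈ unitaryGroup a ℂ)
    (hR : R ∈ unitaryGroup a ℂ) {X : Matrix a a (Matrix b b ℂ)}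
    (h : HasCommProducts (scalarBlocks b P * X * scalarBlocks b R)) :
    HasCommProducts X := by
  obtain ⟨T, hT, h⟩ := h
  refine ⟨T, hT, fun i k => ?_⟩
  rw [← scalarBlocks_conj_cancel hP hR X]
  exact scalarBlocks_mul_mul_mem h i k

theorem comp_mem_unitary_iff (X : Matrix a a (Matrix b b ℂ)) :
    comp a a b b ℂ X ∈ unitaryGroup (a × b) ℂ ↔ X ∈ unitary (Matrix a a (Matrix b b ℂ)) := by
  have hstar : star (comp a a b b ℂ X) = comp a a b b ℂ (star X) := by
    ext ⟨i, r⟩ ⟨k, s⟩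
    simp [star_apply, comp_apply]
  have hmul : ∀ Y Z : Matrix a a (Matrix b b ℂ),
      comp a a b b ℂ Y * comp a a b b ℂ Z = comp a a b b ℂ (Y * Z) :=
    fun Y Z => ((compRingEquiv a b ℂ).map_mul Y Z).symm
  rw [unitaryGroup, Unitary.mem_iff, Unitary.mem_iff, hstar, hmul, hmul, ← comp_one (I := a),
    (comp a a b b ℂ).injective.eq_iff, (comp a a b b ℂ).injective.eq_iff]

theorem isControlledFromA_of_blockDiagonalizable {X : Matrix a a (Matrix b b ℂ)}
    (hX : X ∈ unitary (Matrix a a (Matrix b b ℂ))) (h : BlockDiagonalizable X) :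
    IsControlledFromA (comp a a b b ℂ X) := by
  obtain ⟨P, hP, R, hR, h⟩ := h
  set Y := scalarBlocks b P * X * scalarBlocks b R with hY
  have hYu : Y ∈ unitary (Matrix a a (Matrix b b ℂ)) :=
    mul_mem (mul_mem (scalarBlocks_mem_unitary hP) hX) (scalarBlocks_mem_unitary hR)
  have hYd : Y = diagonal fun j => Y j j := by
    ext1 i k
    by_cases hik : i = k
    · simp [hik]
    · rw [h i k hik, diagonal_apply_ne _ hik]
  refine ⟨fun j => Y j j, fun j => ?_, star P, Unitary.star_mem hP, 1, one_mem _, star R, Unitary.star_mem hR, 1,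
    one_mem _, ?_⟩
  · rw [mem_unitaryGroup_iff']
    have h1 := congrFun (congrFun hYu.1 j) j
    rw [hYd, star_eq_conjTranspose, diagonal_conjTranspose, diagonal_mul_diagonal] at h1
    simpa using h1
  · have h1 : ∑ j, single j j (1 : ℂ) ⊗ₖ Y j j = comp a a b b ℂ Y := by
      conv_rhs => rw [hYd]
      ext ⟨i, r⟩ ⟨k, s⟩
      by_cases hik : i = k
      · subst hik
        simp [Matrix.sum_apply, comp_apply, kroneckerMap_apply, single_apply]
      · simp only [Matrix.sum_apply, comp_apply, kroneckerMap_apply, single_apply,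
          diagonal_apply_ne _ hik, Matrix.zero_apply]
        refine Finset.sum_eq_zero fun t _ => ?_
        rw [if_neg, zero_mul]
        rintro ⟨h1, h2⟩
        exact hik (h1.symm.trans h2)
    rw [h1, ← comp_scalarBlocks, ← comp_scalarBlocks]
    have := scalarBlocks_conj_cancel hP hR X
    rw [← hY] at this
    conv_lhs => rw [← this]
    simp only [← compRingEquiv_apply, map_mul]

theorem mul_apply_eq_of_isometry {X : Matrix a a (Matrix b b ℂ)}
    (hX : X ∈ unitary (Matrix a a (Matrix b b ℂ))) (k l : a) :
    ∑ i, (X i k)ᴴ * X i l = if k = l then 1 else 0 := by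
  have h1 := congrFun (congrFun hX.1 k) l
  rw [mul_apply] at h1
  simp only [star_apply, one_apply] at h1
  rw [← h1]
  rfl

theorem mul_apply_eq_of_coisometry {X : Matrix a a (Matrix b b ℂ)}
    (hX : X ∈ unitary (Matrix a a (Matrix b b ℂ))) (i j : a) :
    ∑ k, X i k * (X j k)ᴴ = if i = j then 1 else 0 := by
  have h1 := congrFun (congrFun hX.2 i) j
  rw [mul_apply] at h1
  simp only [star_apply, one_apply] at h1
  rw [← h1]
  rfl

theorem isControlledFromB_of_diagonal {X : Matrix a a (Matrix b b ℂ)}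
    (hX : X ∈ unitary (Matrix a a (Matrix b b ℂ))) {Q S : Matrix b b ℂ}
    (hQ : Q ∈ unitaryGroup b ℂ) (hS : S ∈ unitaryGroup b ℂ)
    (h : ∀ i k r s, r ≠ s → (Qᴴ * X i k * S) r s = 0) :
    IsControlledFromB (comp a a b b ℂ X) := by
  have hQQ : Q * Qᴴ = 1 := mem_unitaryGroup_iff.mp hQ
  have hSS : S * Sᴴ = 1 := mem_unitaryGroup_iff.mp hS
  have hSS' : Sᴴ * S = 1 := mem_unitaryGroup_iff'.mp hS
  refine ⟨fun r => of fun i k => (Qᴴ * X i k * S) r r, fun r => ?_, 1, one_mem _, Q, hQ, 1,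
    one_mem _, Sᴴ, Unitary.star_mem hS, ?_⟩
  · rw [mem_unitaryGroup_iff']
    ext k l
    have h1 : ∑ i, (Qᴴ * X i k * S)ᴴ * (Qᴴ * X i l * S) =
        if k = l then (1 : Matrix b b ℂ) else 0 := by
      calc _ = Sᴴ * (∑ i, (X i k)ᴴ * X i l) * S := by
            rw [Finset.mul_sum, Finset.sum_mul]
            refine Finset.sum_congr rfl fun i _ => ?_
            simp only [conjTranspose_mul, conjTranspose_conjTranspose, mul_assoc]
            rw [← mul_assoc Q, hQQ, one_mul]
        _ = _ := by
            rw [mul_apply_eq_of_isometry hX]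
            split_ifs <;> simp [hSS']
    have h2 := congrFun (congrFun h1 r) r
    rw [Matrix.sum_apply] at h2
    have h3 : ∀ i, ((Qᴴ * X i k * S)ᴴ * (Qᴴ * X i l * S)) r r =
        star ((Qᴴ * X i k * S) r r) * (Qᴴ * X i l * S) r r := by
      intro i
      rw [mul_apply]
      refine Finset.sum_eq_single r (fun t _ ht => ?_) (by simp)
      rw [h i l t r ht, mul_zero]
    simp only [h3] at h2
    rw [mul_apply, one_apply]
    simp only [star_apply, of_apply, h2]
    split_ifs <;> simp
  · have h1 : ∑ j, (of fun i k => (Qᴴ * X i k * S) j j : Matrix a a ℂ) ⊗ₖ single j j (1 : ℂ) =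
        comp a a b b ℂ (of fun i k => Qᴴ * X i k * S) := by
      ext ⟨i, r⟩ ⟨k, s⟩
      by_cases hrs : r = s
      · subst hrs
        simp [Matrix.sum_apply, comp_apply, kroneckerMap_apply, single_apply]
      · simp only [Matrix.sum_apply, comp_apply, kroneckerMap_apply, single_apply, of_apply]
        rw [h i k r s hrs]
        refine Finset.sum_eq_zero fun t _ => ?_
        rw [if_neg, mul_zero]
        rintro ⟨h1, h2⟩
        exact hrs (h1.symm.trans h2)
    have hk : ∀ M : Matrix b b ℂ,
        (1 : Matrix a a ℂ) ⊗ₖ M = comp a a b b ℂ (diagonal fun _ => M) := by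
      intro M
      ext ⟨i, r⟩ ⟨k, s⟩
      by_cases hik : i = k
      · subst hik
        simp [comp_apply, kroneckerMap_apply]
      · simp [comp_apply, kroneckerMap_apply, diagonal_apply_ne _ hik, one_apply_ne hik]
    rw [h1, hk, hk]
    simp only [← compRingEquiv_apply, ← map_mul]
    congr 1
    ext1 i k
    rw [mul_diagonal, diagonal_mul, of_apply]
    calc X i k = (Q * Qᴴ) * X i k * (S * Sᴴ) := by rw [hQQ, hSS, one_mul, mul_one]
      _ = _ := by simp only [mul_assoc]

/-- In a common eigenbasis `S` of the products, columns r ≠ s of any two matrices `X i k * S` and `X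
j l * S` are orthogonal. Normalizing one nonzero r-th column for each r gives the unitary `Q` for
which all Qᴴ X i k S are diagonal. -/
theorem isControlledFromB_of_hasCommProducts [Nonempty a] {X : Matrix a a (Matrix b b ℂ)}
    (hX : X ∈ unitary (Matrix a a (Matrix b b ℂ))) (h : HasCommProducts X) :
    IsControlledFromB (comp a a b b ℂ X) := by
  obtain ⟨T, hT, hmem⟩ := h
  have hC := hT.span
  obtain ⟨S, hS, hD⟩ := exists_unitary_of_commute_normal
    (fun p : (a × a) × (a × a) => (X p.1.1 p.1.2)ᴴ * X p.2.1 p.2.2)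
    (fun p q => hC _ (hmem _ _) _ (hmem _ _) _ (hmem _ _) _ (hmem _ _))
    (fun p q => by
      rw [conjTranspose_mul, conjTranspose_conjTranspose]
      exact hC _ (hmem _ _) _ (hmem _ _) _ (hmem _ _) _ (hmem _ _))
  have hSS' : Sᴴ * S = 1 := mem_unitaryGroup_iff'.mp hS
  have horth : ∀ i k j l r s, r ≠ s → ((X i k * S)ᴴ * (X j l * S)) r s = 0 := by
    intro i k j l r s hrs
    obtain ⟨D, hD⟩ := hD ((i, k), (j, l))
    have : (X i k * S)ᴴ * (X j l * S) = diagonal D := by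
      calc _ = Sᴴ * ((X i k)ᴴ * X j l * S) := by simp only [conjTranspose_mul, mul_assoc]
        _ = _ := by rw [hD, ← mul_assoc, hSS', one_mul]
    rw [this, diagonal_apply_ne _ hrs]
  -- Were the r-th column of every `X i k * S` zero, the isometry relation for a block column would
  -- read 0 = 1 at (r, r).
  have hne : ∀ r, ∃ p : a × a, ((X p.1 p.2 * S)ᴴ * (X p.1 p.2 * S)) r r ≠ 0 := by
    intro r
    by_contra! hr
    obtain ⟨k⟩ := ‹Nonempty a›
    have h1 : ∑ i, (X i k * S)ᴴ * (X i k * S) = 1 := by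
      calc _ = Sᴴ * (∑ i, (X i k)ᴴ * X i k) * S := by
            rw [Finset.mul_sum, Finset.sum_mul]
            simp only [conjTranspose_mul, mul_assoc]
        _ = _ := by rw [mul_apply_eq_of_isometry hX, if_pos rfl, mul_one, hSS']
    have h2 := congrFun (congrFun h1 r) r
    rw [Matrix.sum_apply, Finset.sum_eq_zero fun i _ => hr (i, k)] at h2
    simp at h2
  choose p hp using hne
  let N : b → ℝ := fun r => ∑ t, ‖(X (p r).1 (p r).2 * S) t r‖ ^ 2
  have hNeq : ∀ r, ((X (p r).1 (p r).2 * S)ᴴ * (X (p r).1 (p r).2 * S)) r r = (N r : ℂ) := by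
    intro r
    rw [mul_apply]
    simp only [N, Complex.ofReal_sum, conjTranspose_apply]
    refine Finset.sum_congr rfl fun t _ => ?_
    rw [← starRingEnd_apply, Complex.conj_mul', Complex.ofReal_pow]
  have hN : ∀ r, 0 < N r := by
    intro r
    have h0 : 0 ≤ N r := Finset.sum_nonneg fun t _ => by positivity
    refine lt_of_le_of_ne h0 fun h => hp r ?_
    rw [hNeq, ← h, Complex.ofReal_zero]
  let Q : Matrix b b ℂ :=
    of fun t r => ((Real.sqrt (N r))⁻¹ : ℝ) * (X (p r).1 (p r).2 * S) t r
  have hQm : ∀ (M : Matrix b b ℂ) r s, (Qᴴ * M) r s =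
      ((Real.sqrt (N r))⁻¹ : ℝ) * ((X (p r).1 (p r).2 * S)ᴴ * M) r s := by
    intro M r s
    rw [mul_apply, mul_apply, Finset.mul_sum]
    refine Finset.sum_congr rfl fun t _ => ?_
    simp only [Q, conjTranspose_apply, of_apply, star_mul', Complex.star_def,
      Complex.conj_ofReal, mul_assoc]
  have hQ : Q ∈ unitaryGroup b ℂ := by
    rw [mem_unitaryGroup_iff']
    ext r s
    have h1 : ((X (p r).1 (p r).2 * S)ᴴ * Q) r s =
        ((Real.sqrt (N s))⁻¹ : ℝ) *
          ((X (p r).1 (p r).2 * S)ᴴ * (X (p s).1 (p s).2 * S)) r s := by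
      rw [mul_apply, mul_apply, Finset.mul_sum]
      refine Finset.sum_congr rfl fun t _ => ?_
      simp only [Q, of_apply]
      ring
    rw [star_eq_conjTranspose, hQm, h1]
    by_cases hrs : r = s
    · subst hrs
      rw [hNeq, one_apply_eq, ← Complex.ofReal_mul, ← Complex.ofReal_mul]
      have h2 := Real.sq_sqrt (hN r).le
      have h3 := Real.sqrt_pos.mpr (hN r)
      norm_cast
      field_simp
      exact h2.symm
    · rw [horth _ _ _ _ r s hrs, one_apply_ne hrs, mul_zero, mul_zero]
  refine isControlledFromB_of_diagonal hX hQ hS fun i k r s hrs => ?_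
  rw [mul_assoc, hQm, horth _ _ _ _ r s hrs, mul_zero]

end Blocks

/-! ### Splitting off a product column. -/

section Reducible

set_option linter.unusedSectionVars false

variable {a b : Type*} [Fintype a] [Fintype b] [DecidableEq a] [DecidableEq b]

theorem exists_unitary_col (i : a) {y : a → ℂ} (hy : y ≠ 0) :
    ∃ R ∈ unitaryGroup a ℂ, ∃ c : ℂ, c ≠ 0 ∧ ∀ k, R k i = c * y k := by
  let v : EuclideanSpace ℂ a := WithLp.toLp 2 y
  have hv : v ≠ 0 := by
    intro h
    apply hy
    have := congrArg WithLp.ofLp h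
    simpa [v] using this
  have hn : ‖v‖ ≠ 0 := norm_ne_zero_iff.mpr hv
  let w : EuclideanSpace ℂ a := ((‖v‖ : ℂ)⁻¹) • v
  have hw : ‖w‖ = 1 := by simp [w, norm_smul, hn]
  have horth : Orthonormal ℂ (Set.domRestrict {i} fun _ : a => w) := by
    constructor
    · intro _
      exact hw
    · intro p q hpq
      exact absurd (Subsingleton.elim p q) hpq
  obtain ⟨e, he⟩ := horth.exists_orthonormalBasis_extension_of_card_eq (by simp)
  refine ⟨_, mem_unitaryGroup_of_orthonormalBasis e, (‖v‖ : ℂ)⁻¹, by simpa using hv, fun k => ?_⟩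
  rw [of_apply, he i rfl]
  simp [w, v]

/-- Some nonzero combination of the block columns of `X` is a product vector. -/
def Reducible (X : Matrix a a (Matrix b b ℂ)) : Prop :=
  ∃ y : a → ℂ, y ≠ 0 ∧ ∃ (x : a → ℂ) (V : Matrix b b ℂ), ∀ i, ∑ k, y k • X i k = x i • V

/-- Take `y` and `x`, normalized, as columns `i₀` of the two unitaries. The new column `i₀` is then
supported at `i₀`, and orthogonality of the columns clears the row. -/
theorem Reducible.exists_split {X : Matrix a a (Matrix b b ℂ)} (h : Reducible X)
    (hX : X ∈ unitary (Matrix a a (Matrix b b ℂ))) (i₀ : a) :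
    ∃ P ∈ unitaryGroup a ℂ, ∃ R ∈ unitaryGroup a ℂ,
      (∀ i, i ≠ i₀ → (scalarBlocks b P * X * scalarBlocks b R) i i₀ = 0) ∧
      ∀ k, k ≠ i₀ → (scalarBlocks b P * X * scalarBlocks b R) i₀ k = 0 := by
  -- If x = 0, any nonzero vector can replace it, with V = 0.
  obtain ⟨y, hy, x, V, hxV⟩ : ∃ y : a → ℂ, y ≠ 0 ∧ ∃ (x : {x : a → ℂ // x ≠ 0})
      (V : Matrix b b ℂ), ∀ i, ∑ k, y k • X i k = x.1 i • V := by
    obtain ⟨y, hy, x, V, hxV⟩ := h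
    by_cases hx : x = 0
    · exact ⟨y, hy, ⟨y, hy⟩, 0, fun i => by simp [hxV, hx]⟩
    · exact ⟨y, hy, ⟨x, hx⟩, V, hxV⟩
  obtain ⟨R, hR, c, -, hRc⟩ := exists_unitary_col i₀ hy
  obtain ⟨P, hP, e, he, hPe⟩ := exists_unitary_col i₀ x.2
  refine ⟨star P, Unitary.star_mem hP, R, hR, ?_⟩
  have hYu : scalarBlocks b (star P) * X * scalarBlocks b R ∈
      unitary (Matrix a a (Matrix b b ℂ)) :=
    mul_mem (mul_mem (scalarBlocks_mem_unitary (Unitary.star_mem hP)) hX)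
      (scalarBlocks_mem_unitary hR)
  have hcol : ∀ i, i ≠ i₀ → (scalarBlocks b (star P) * X * scalarBlocks b R) i i₀ = 0 := by
    intro i hi
    have h1 : (scalarBlocks b (star P) * X * scalarBlocks b R) i i₀ =
        (c * e⁻¹ * (star P * P) i i₀) • V := by
      rw [scalarBlocks_mul_mul_apply, Finset.sum_comm]
      have h2 : ∀ j, ∑ l, (star P i j * R l i₀) • X j l =
          (c * e⁻¹ * (star P i j * P j i₀)) • V := by
        intro j
        calc _ = (star P i j * c) • ∑ l, y l • X j l := by
              rw [Finset.smul_sum]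
              refine Finset.sum_congr rfl fun l _ => ?_
              rw [hRc, smul_smul]
              ring_nf
          _ = _ := by
              rw [hxV, smul_smul, hPe]
              congr 1
              field_simp
      rw [Finset.sum_congr rfl fun j _ => h2 j, ← Finset.sum_smul, ← Finset.mul_sum, mul_apply]
    rw [h1, mem_unitaryGroup_iff'.mp hP, one_apply_ne hi, mul_zero, zero_smul]
  refine ⟨hcol, fun k hk => ?_⟩
  set Y := scalarBlocks b (star P) * X * scalarBlocks b R
  have h1 := mul_apply_eq_of_isometry hYu i₀ i₀
  have h2 := mul_apply_eq_of_isometry hYu i₀ k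
  rw [Finset.sum_eq_single i₀ (fun i _ hi => by rw [hcol i hi]; simp) (by simp), if_pos rfl] at h1
  rw [Finset.sum_eq_single i₀ (fun i _ hi => by rw [hcol i hi]; simp) (by simp),
    if_neg (Ne.symm hk)] at h2
  -- The corner block is an isometry, and being square it is unitary, so orthogonality to it forces
  -- `Y i₀ k` to vanish.
  calc Y i₀ k = (Y i₀ i₀ * (Y i₀ i₀)ᴴ) * Y i₀ k := by rw [mul_eq_one_comm.mp h1, one_mul]
    _ = 0 := by rw [mul_assoc, h2, mul_zero]

theorem Reducible.blockDiagonalizable {X : Matrix (Fin 2) (Fin 2) (Matrix b b ℂ)}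
    (h : Reducible X) (hX : X ∈ unitary (Matrix (Fin 2) (Fin 2) (Matrix b b ℂ))) :
    BlockDiagonalizable X := by
  obtain ⟨P, hP, R, hR, h1, h2⟩ := h.exists_split hX 0
  refine ⟨P, hP, R, hR, fun i k hik => ?_⟩
  by_cases hk : k = 0
  · subst hk
    exact h1 i hik
  · have hi : i = 0 := by omega
    subst hi
    exact h2 k hk

/-- The block matrix `1 ⊕ P`. -/
def extendOne {n : ℕ} (P : Matrix (Fin n) (Fin n) ℂ) : Matrix (Fin (n + 1)) (Fin (n + 1)) ℂ :=
  of fun i k => Fin.cases (Fin.cases 1 (fun _ => 0) k) (fun i' => Fin.cases 0 (fun k' => P i' k') k)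
    i

theorem extendOne_mem_unitary {n : ℕ} {P : Matrix (Fin n) (Fin n) ℂ}
    (hP : P ∈ unitaryGroup (Fin n) ℂ) : extendOne P ∈ unitaryGroup (Fin (n + 1)) ℂ := by
  have h := mem_unitaryGroup_iff'.mp hP
  rw [mem_unitaryGroup_iff']
  ext i k
  induction i using Fin.cases with
  | zero =>
    induction k using Fin.cases with
    | zero => simp [mul_apply, Fin.sum_univ_succ, star_apply, extendOne]
    | succ k => simp [mul_apply, Fin.sum_univ_succ, star_apply, extendOne, one_apply, Fin.ext_iff]
  | succ i =>
    induction k using Fin.cases with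
    | zero => simp [mul_apply, Fin.sum_univ_succ, star_apply, extendOne, one_apply, Fin.ext_iff]
    | succ k =>
      have := congrFun (congrFun h i) k
      simp only [mul_apply, star_apply, one_apply] at this
      simpa [mul_apply, Fin.sum_univ_succ, star_apply, extendOne, one_apply] using this

theorem BlockDiagonalizable.extendOne {n : ℕ}
    {X : Matrix (Fin (n + 1)) (Fin (n + 1)) (Matrix b b ℂ)}
    (hcol : ∀ i, i ≠ 0 → X i 0 = 0) (hrow : ∀ k, k ≠ 0 → X 0 k = 0)
    (h : BlockDiagonalizable (X.submatrix Fin.succ Fin.succ)) : BlockDiagonalizable X := by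
  obtain ⟨P, hP, R, hR, h⟩ := h
  refine ⟨_, extendOne_mem_unitary hP, _, extendOne_mem_unitary hR, fun i k hik => ?_⟩
  rw [scalarBlocks_mul_mul_apply]
  induction i using Fin.cases with
  | zero =>
    induction k using Fin.cases with
    | zero => exact absurd rfl hik
    | succ k => simp [Fin.sum_univ_succ, BipartiteUnitary.extendOne, hrow]
  | succ i =>
    induction k using Fin.cases with
    | zero => simp [Fin.sum_univ_succ, BipartiteUnitary.extendOne, hcol]
    | succ k =>
      have := h i k (fun h => hik (by rw [h]))
      rw [scalarBlocks_mul_mul_apply] at this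
      simpa [Fin.sum_univ_succ, BipartiteUnitary.extendOne] using this

theorem submatrix_succ_mem_unitary {n : ℕ}
    {X : Matrix (Fin (n + 1)) (Fin (n + 1)) (Matrix b b ℂ)}
    (hX : X ∈ unitary (Matrix (Fin (n + 1)) (Fin (n + 1)) (Matrix b b ℂ)))
    (hcol : ∀ i, i ≠ 0 → X i 0 = 0) (hrow : ∀ k, k ≠ 0 → X 0 k = 0) :
    X.submatrix Fin.succ Fin.succ ∈ unitary (Matrix (Fin n) (Fin n) (Matrix b b ℂ)) := by
  constructor
  · ext1 k l
    have h := congrFun (congrFun hX.1 k.succ) l.succ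
    rw [mul_apply, Fin.sum_univ_succ] at h
    simp only [star_apply, hrow _ (Fin.succ_ne_zero _), mul_zero, zero_add, one_apply,
      Fin.succ_inj] at h
    simpa [mul_apply, star_apply, one_apply] using h
  · ext1 k l
    have h := congrFun (congrFun hX.2 k.succ) l.succ
    rw [mul_apply, Fin.sum_univ_succ] at h
    simp only [star_apply, hcol _ (Fin.succ_ne_zero _), zero_mul, zero_add, one_apply,
      Fin.succ_inj] at h
    simpa [mul_apply, star_apply, one_apply] using h

theorem exists_linear_relation {ι M : Type*} [Fintype ι] [AddCommGroup M] [Module ℂ M]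
    (W : Submodule ℂ M) [FiniteDimensional ℂ W] (v : ι → M) (hv : ∀ i, v i ∈ W)
    (hW : Module.finrank ℂ W < Fintype.card ι) : ∃ g : ι → ℂ, ∑ i, g i • v i = 0 ∧ g ≠ 0 := by
  have h : ¬ LinearIndependent ℂ fun i => (⟨v i, hv i⟩ : W) := fun h =>
    absurd h.fintype_card_le_finrank (not_le.mpr hW)
  obtain ⟨g, hg, i, hi⟩ := Fintype.not_linearIndependent_iff.mp h
  refine ⟨g, ?_, fun h0 => hi (by rw [h0]; rfl)⟩
  have := congrArg Subtype.val hg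
  simpa using this

/-- A nonzero singular `F` is an outer product x yᵀ, so the relation says that the two entries of
the combined column Σ yₖ Y · k are linearly dependent, which makes it a product vector. -/
theorem reducible_of_singular_relation {Y : Matrix (Fin 2) (Fin 2) (Matrix b b ℂ)}
    {F : Matrix (Fin 2) (Fin 2) ℂ} (hF : F ≠ 0) (hdet : F.det = 0)
    (h : ∑ i, ∑ k, F i k • Y i k = 0) : Reducible Y := by
  obtain ⟨v, hv, hFv⟩ := exists_mulVec_eq_zero_iff.mpr hdet
  have hv' : ∀ i, F i 0 * v 0 + F i 1 * v 1 = 0 := fun i => by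
    have := congrFun hFv i
    simpa [mulVec, dotProduct, Fin.sum_univ_two] using this
  -- Every row of `F` annihilates `v`, hence is a multiple of (v₁, −v₀).
  let y : Fin 2 → ℂ := ![v 1, -v 0]
  obtain ⟨x, hx⟩ : ∃ x : Fin 2 → ℂ, ∀ i k, F i k = x i * y k := by
    by_cases h1 : v 1 = 0
    · have h0 : v 0 ≠ 0 := fun h0 => hv (by ext i; fin_cases i <;> simp [h0, h1])
      refine ⟨fun i => -F i 1 / v 0, fun i k => ?_⟩
      have := hv' i
      fin_cases k
      · simp [y, h1]
        simpa [h1, h0] using this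
      · simp [y]
        field_simp
    · refine ⟨fun i => F i 0 / v 1, fun i k => ?_⟩
      have := hv' i
      fin_cases k
      · simp [y]
        field_simp
      · simp [y]
        field_simp
        linear_combination this
  have hy : y ≠ 0 := fun h0 => hF (by ext i k; simp [hx, h0])
  have hx0 : x ≠ 0 := fun h0 => hF (by ext i k; simp [hx, h0])
  have hrel : x 0 • (∑ k, y k • Y 0 k) + x 1 • (∑ k, y k • Y 1 k) = 0 := by
    rw [← h]
    simp only [Fin.sum_univ_two, hx, smul_add, smul_smul]
  refine ⟨y, hy, ?_⟩
  by_cases h1 : x 1 = 0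
  · have h0 : x 0 ≠ 0 := fun h0 => hx0 (by ext i; fin_cases i <;> simp [h0, h1])
    rw [h1, zero_smul, add_zero, smul_eq_zero_iff_right h0] at hrel
    refine ⟨![0, 1], ∑ k, y k • Y 1 k, fun i => ?_⟩
    fin_cases i
    · simpa using hrel
    · simp
  · refine ⟨![1, -(x 0 / x 1)], ∑ k, y k • Y 0 k, fun i => ?_⟩
    fin_cases i
    · simp
    · have : ∑ k, y k • Y 1 k = -(x 0 / x 1) • ∑ k, y k • Y 0 k := by
        have h3 : ∑ k, y k • Y 1 k = (x 1)⁻¹ • (x 1 • ∑ k, y k • Y 1 k) := by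
          rw [smul_smul, inv_mul_cancel₀ h1, one_smul]
        rw [h3, eq_neg_of_add_eq_zero_right hrel, smul_neg, smul_smul, neg_smul]
        ring_nf
      simpa using this

/-- The determinant is a quadratic polynomial in t with leading coefficient `G.det`. -/
theorem exists_det_add_smul_eq_zero (F : Matrix (Fin 2) (Fin 2) ℂ) {G : Matrix (Fin 2) (Fin 2) ℂ}
    (hG : G.det ≠ 0) : ∃ t : ℂ, (F + t • G).det = 0 := by
  let B := F 0 0 * G 1 1 + G 0 0 * F 1 1 - F 0 1 * G 1 0 - G 0 1 * F 1 0
  obtain ⟨s, hs⟩ := IsAlgClosed.exists_eq_mul_self (discrim G.det B F.det)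
  obtain ⟨t, ht⟩ := exists_quadratic_eq_zero hG ⟨s, hs⟩
  refine ⟨t, ?_⟩
  rw [← ht]
  simp only [det_fin_two, Matrix.add_apply, Matrix.smul_apply, smul_eq_mul, B]
  ring

end Reducible

/-! ### Unitary 2 × 2 block matrices with a linear relation between the blocks. -/

section TwoByTwo

variable {b : Type*} [Fintype b] [DecidableEq b]

/-- The hypotheses are the unitarity relations of [[x, y], [z, −x]]. They leave only `H`, `K`, `K'`,
`L`, `L'` and 1 − `H` as products; these commute by regrouping pᴴq·rᴴs as pᴴ(q rᴴ)s and rewriting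
the middle factor with the row relations. -/
theorem commProducts_of_traceless_unitary {x y z : Matrix b b ℂ}
    (h1 : xᴴ * x + zᴴ * z = 1) (h2 : yᴴ * y + xᴴ * x = 1) (h3 : xᴴ * y = zᴴ * x)
    (h4 : x * xᴴ + y * yᴴ = 1) (h5 : z * zᴴ + x * xᴴ = 1) (h6 : x * zᴴ = y * xᴴ) :
    CommProducts {x, y, z} := by
  have h3' : yᴴ * x = xᴴ * z := by simpa using congrArg conjTranspose h3
  have h6' : z * xᴴ = x * yᴴ := by simpa using congrArg conjTranspose h6
  have hzz : zᴴ * z = 1 - xᴴ * x := eq_sub_of_add_eq' h1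
  have hyy : yᴴ * y = 1 - xᴴ * x := eq_sub_of_add_eq h2
  have hyy' : y * yᴴ = 1 - x * xᴴ := eq_sub_of_add_eq' h4
  have hzz' : z * zᴴ = 1 - x * xᴴ := eq_sub_of_add_eq h5
  have hzy : z * zᴴ = y * yᴴ := hzz'.trans hyy'.symm
  have hyx : x * xᴴ = 1 - y * yᴴ := eq_sub_of_add_eq h4
  set H := xᴴ * x with hH
  set K := xᴴ * y with hK
  set K' := yᴴ * x with hK'
  set L := yᴴ * z with hL
  set L' := zᴴ * y with hL'
  clear_value H K K' L L'
  have c1 : Commute H K := by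
    show H * K = K * H
    calc H * K = xᴴ * x * (zᴴ * x) := by rw [h3, hH]
      _ = xᴴ * (x * zᴴ) * x := by simp only [mul_assoc]
      _ = K * H := by rw [h6]; simp only [hK, hH, mul_assoc]
  have c2 : Commute H K' := by
    show H * K' = K' * H
    calc H * K' = xᴴ * (x * yᴴ) * x := by simp only [hK', hH, mul_assoc]
      _ = (xᴴ * z) * (xᴴ * x) := by rw [← h6']; simp only [mul_assoc]
      _ = K' * H := by rw [← h3', hH]
  have c3 : Commute H L := by
    show H * L = L * H
    calc H * L = xᴴ * (x * yᴴ) * z := by simp only [hL, hH, mul_assoc]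
      _ = (xᴴ * z) * (xᴴ * z) := by rw [← h6']; simp only [mul_assoc]
      _ = yᴴ * (x * yᴴ) * x := by rw [← h3']; simp only [hK', mul_assoc]
      _ = L * H := by rw [← h6']; simp only [hL, hH, mul_assoc]
  have c4 : Commute H L' := by
    show H * L' = L' * H
    calc H * L' = xᴴ * (x * zᴴ) * y := by simp only [hL', hH, mul_assoc]
      _ = (xᴴ * y) * (xᴴ * y) := by rw [h6]; simp only [mul_assoc]
      _ = zᴴ * (x * zᴴ) * x := by rw [← hK, h3]; simp only [mul_assoc]
      _ = L' * H := by rw [h6]; simp only [hL', hH, mul_assoc]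
  have c5 : Commute K K' := by
    show K * K' = K' * K
    calc K * K' = xᴴ * (y * yᴴ) * x := by simp only [hK, hK', mul_assoc]
      _ = H - H * H := by rw [hyy', hH]; noncomm_ring
      _ = (1 - H) - (1 - H) * (1 - H) := by noncomm_ring
      _ = yᴴ * (1 - y * yᴴ) * y := by rw [← hyy]; noncomm_ring
      _ = K' * K := by rw [← hyx]; simp only [hK, hK', mul_assoc]
  have c6 : Commute K L := by
    show K * L = L * K
    calc K * L = xᴴ * (y * yᴴ) * z := by simp only [hK, hL, mul_assoc]
      _ = (xᴴ * z) - H * (xᴴ * z) := by rw [hyy', hH]; noncomm_ring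
      _ = K' - K' * H := by rw [← h3', c2.eq]
      _ = K' * (1 - H) := by noncomm_ring
      _ = yᴴ * (x * yᴴ) * y := by rw [← hyy]; simp only [hK', mul_assoc]
      _ = L * K := by rw [← h6']; simp only [hK, hL, mul_assoc]
  have c7 : Commute K L' := by
    show K * L' = L' * K
    calc K * L' = zᴴ * (x * zᴴ) * y := by rw [h3]; simp only [hL', mul_assoc]
      _ = L' * K := by rw [h6]; simp only [hL', hK, mul_assoc]
  have c8 : Commute K' L := by
    show K' * L = L * K'
    calc K' * L = yᴴ * (x * yᴴ) * z := by simp only [hL, hK', mul_assoc]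
      _ = L * (xᴴ * z) := by rw [← h6']; simp only [hL, mul_assoc]
      _ = L * K' := by rw [h3']
  have c9 : Commute K' L' := by
    show K' * L' = L' * K'
    calc K' * L' = xᴴ * (z * zᴴ) * y := by rw [h3']; simp only [hL', mul_assoc]
      _ = K - H * K := by rw [hzz', hK, hH]; noncomm_ring
      _ = zᴴ * x - (zᴴ * x) * H := by rw [c1.eq, h3]
      _ = zᴴ * (1 - x * xᴴ) * x := by rw [hH]; noncomm_ring
      _ = L' * K' := by rw [← hyy']; simp only [hL', hK', mul_assoc]
  have c10 : Commute L L' := by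
    show L * L' = L' * L
    calc L * L' = yᴴ * (z * zᴴ) * y := by simp only [hL, hL', mul_assoc]
      _ = (yᴴ * y) * (yᴴ * y) := by rw [hzy]; simp only [mul_assoc]
      _ = (zᴴ * z) * (zᴴ * z) := by rw [hyy, hzz]
      _ = zᴴ * (z * zᴴ) * z := by simp only [mul_assoc]
      _ = L' * L := by rw [hzy]; simp only [hL, hL', mul_assoc]
  have key : ∀ p ∈ ({H, K, K', L, L'} : Set (Matrix b b ℂ)),
      ∀ q ∈ ({H, K, K', L, L'} : Set (Matrix b b ℂ)), Commute p q := by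
    rintro p (hp | hp | hp | hp | hp) q (hq | hq | hq | hq | hq) <;> rw [hp, hq] <;>
      first
        | exact Commute.refl _
        | assumption
        | (apply Commute.symm; assumption)
  have hmem : ∀ p ∈ ({x, y, z} : Set (Matrix b b ℂ)), ∀ q ∈ ({x, y, z} : Set (Matrix b b ℂ)),
      pᴴ * q ∈ ({H, K, K', L, L'} : Set (Matrix b b ℂ)) ∨ pᴴ * q = 1 - H := by
    rintro p (hp | hp | hp) q (hq | hq | hq) <;> rw [hp, hq]
    · simp [hH]
    · simp [hK]
    · rw [← h3']; simp
    · simp [hK']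
    · exact Or.inr hyy
    · simp [hL]
    · rw [← h3]; simp
    · simp [hL']
    · exact Or.inr hzz
  intro p hp q hq r hr s hs
  rcases hmem p hp q hq with h | h <;> rcases hmem r hr s hs with h' | h'
  · exact key _ h _ h'
  · rw [h']
    exact (Commute.one_right _).sub_right (key _ h _ (by simp))
  · rw [h]
    exact (Commute.one_left _).sub_left (key _ (by simp) _ h')
  · rw [h, h']

/-- Passing from `F` to adj(F)ᴴ preserves the Hilbert–Schmidt norm of Σ Fᵢₖ Yᵢₖ: the difference of
the squared norms is a combination of the traces of the row and column relations. This is the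
spin-flip symmetry of a two-qubit state with maximally mixed marginals. -/
theorem conj_relation {Y : Matrix (Fin 2) (Fin 2) (Matrix b b ℂ)}
    (hY : Y ∈ unitary (Matrix (Fin 2) (Fin 2) (Matrix b b ℂ))) {F : Matrix (Fin 2) (Fin 2) ℂ}
    (h : ∑ i, ∑ k, F i k • Y i k = 0) :
    ∑ i, ∑ k, (F.adjugate)ᴴ i k • Y i k = 0 := by
  rw [← trace_conjTranspose_mul_self_eq_zero_iff]
  have h0 : trace ((∑ i, ∑ k, F i k • Y i k)ᴴ * ∑ i, ∑ k, F i k • Y i k) = 0 := by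
    rw [h, mul_zero, trace_zero]
  have hc : ∀ k l, trace ((Y 0 k)ᴴ * Y 0 l) + trace ((Y 1 k)ᴴ * Y 1 l) =
      if k = l then (Fintype.card b : ℂ) else 0 := by
    intro k l
    have := congrArg trace (mul_apply_eq_of_isometry hY k l)
    rw [Fin.sum_univ_two, trace_add] at this
    rw [this]
    split_ifs <;> simp
  have hr : ∀ i j, trace ((Y j 0)ᴴ * Y i 0) + trace ((Y j 1)ᴴ * Y i 1) =
      if i = j then (Fintype.card b : ℂ) else 0 := by
    intro i j
    have := congrArg trace (mul_apply_eq_of_coisometry hY i j)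
    rw [Fin.sum_univ_two, trace_add, trace_mul_comm, trace_mul_comm (Y i 1)] at this
    rw [this]
    split_ifs <;> simp
  have c00 := hc 0 0
  have c01 := hc 0 1
  have c10 := hc 1 0
  have c11 := hc 1 1
  have r00 := hr 0 0
  have r01 := hr 0 1
  have r10 := hr 1 0
  have r11 := hr 1 1
  simp only [if_true, zero_ne_one, one_ne_zero, if_false] at c00 c01 c10 c11 r00 r01 r10 r11
  rw [← h0]
  simp only [Fin.sum_univ_two, adjugate_fin_two, conjTranspose_apply, of_apply, cons_val',
    cons_val_zero, cons_val_one, cons_val_fin_one, conjTranspose_add, conjTranspose_smul, add_mul,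
    mul_add, smul_mul_assoc, mul_smul_comm, trace_add, trace_smul, smul_eq_mul, star_neg, star_star]
  linear_combination (F 1 1 * star (F 1 1) - F 0 0 * star (F 0 0)) * (c00 - r11) +
    (F 1 0 * star (F 1 0) - F 0 1 * star (F 0 1)) * (r00 - c00) -
    (F 1 1 * star (F 1 0) + F 0 1 * star (F 0 0)) * c01 -
    (F 1 0 * star (F 1 1) + F 0 0 * star (F 0 1)) * c10 -
    (F 1 1 * star (F 0 1) + F 1 0 * star (F 0 0)) * r10 -
    (F 0 1 * star (F 1 1) + F 0 0 * star (F 1 0)) * r01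

/-- For invertible `F` the adjugate is a multiple of the inverse, so Fᴴ is proportional to F⁻¹. The
scalar is the inverse norm of the first row. -/
theorem exists_smul_mem_unitary_of_adjugate {F : Matrix (Fin 2) (Fin 2) ℂ} (hF : F.det ≠ 0)
    {t : ℂ} (h : F.adjugateᴴ + t • F = 0) : ∃ c : ℂ, c • Fᵀ ∈ unitaryGroup (Fin 2) ℂ := by
  have e : ∀ i k, star (F.adjugate k i) = -t * F i k := fun i k => by
    have := congrFun (congrFun h i) k
    simp only [Matrix.add_apply, conjTranspose_apply, Matrix.smul_apply, smul_eq_mul,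
      Matrix.zero_apply] at this
    linear_combination this
  have e00 := e 0 0
  have e01 := e 0 1
  have e10 := e 1 0
  have e11 := e 1 1
  simp only [adjugate_fin_two, of_apply, cons_val', cons_val_zero, cons_val_one, cons_val_fin_one,
    star_neg] at e00 e01 e10 e11
  let r : ℝ := Complex.normSq (F 0 0) + Complex.normSq (F 0 1)
  have hr : (r : ℂ) = F 0 0 * star (F 0 0) + F 0 1 * star (F 0 1) := by
    simp only [r, Complex.ofReal_add, Complex.normSq_eq_conj_mul_self, Complex.star_def]
    ring
  have hr0 : 0 < r := by
    have h0 : 0 ≤ r := add_nonneg (Complex.normSq_nonneg _) (Complex.normSq_nonneg _)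
    refine lt_of_le_of_ne h0 fun h => hF ?_
    have h1 : F 0 0 = 0 := Complex.normSq_eq_zero.mp
      (le_antisymm (by linarith [Complex.normSq_nonneg (F 0 1)]) (Complex.normSq_nonneg _))
    have h2 : F 0 1 = 0 := Complex.normSq_eq_zero.mp
      (le_antisymm (by linarith [Complex.normSq_nonneg (F 0 0)]) (Complex.normSq_nonneg _))
    rw [det_fin_two, h1, h2]
    ring
  refine ⟨((Real.sqrt r)⁻¹ : ℝ), ?_⟩
  have hs : (((Real.sqrt r)⁻¹ : ℝ) : ℂ) * ((Real.sqrt r)⁻¹ : ℝ) * r = 1 := by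
    norm_cast
    have h3 := Real.sqrt_pos.mpr hr0
    have h2 := Real.sq_sqrt hr0.le
    field_simp
    exact h2.symm
  rw [mem_unitaryGroup_iff']
  set c : ℝ := (Real.sqrt r)⁻¹
  rw [hr] at hs
  ext i k
  fin_cases i <;> fin_cases k <;>
    simp only [mul_apply, Fin.sum_univ_two, star_apply, Matrix.smul_apply, transpose_apply,
      smul_eq_mul, star_mul', Complex.star_def, Complex.conj_ofReal, Fin.zero_eta, Fin.mk_one,
      one_apply_eq, one_apply_ne, ne_eq, zero_ne_one, one_ne_zero, not_false_eq_true] <;>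
    simp only [Complex.star_def] at e00 e01 e10 e11 hs
  · linear_combination hs
  · linear_combination (c : ℂ) ^ 2 * (F 1 0 * e11 - F 1 1 * e10)
  · linear_combination (c : ℂ) ^ 2 * (F 0 1 * e00 - F 0 0 * e01)
  · linear_combination hs + (c : ℂ) ^ 2 * (F 1 1 * e00 - F 1 0 * e01 - F 0 0 * e11 + F 0 1 * e10)

/-- Four blocks in dimension 3 satisfy a relation `F`, and adj(F)ᴴ is another. Some adj(F)ᴴ + tF is
singular; as singular nonzero relations are excluded, it is zero, so `F` is proportional to a
unitary. Since Σ Fᵢₖ Yᵢₖ is the block trace of FᵀY, multiplying by Fᵀ makes the block trace vanish.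
-/
theorem exists_traceless_form {Y : Matrix (Fin 2) (Fin 2) (Matrix b b ℂ)}
    (hY : Y ∈ unitary (Matrix (Fin 2) (Fin 2) (Matrix b b ℂ))) (hred : ¬ BlockDiagonalizable Y)
    {W : Submodule ℂ (Matrix b b ℂ)} (hW : Module.finrank ℂ W ≤ 3) (hYW : ∀ i k, Y i k ∈ W) :
    ∃ P ∈ unitaryGroup (Fin 2) ℂ,
      (scalarBlocks b P * Y * scalarBlocks b (1 : Matrix (Fin 2) (Fin 2) ℂ)) 1 1 =
        -(scalarBlocks b P * Y * scalarBlocks b (1 : Matrix (Fin 2) (Fin 2) ℂ)) 0 0 := by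
  obtain ⟨g, hg, hg0⟩ := exists_linear_relation W (fun p : Fin 2 × Fin 2 => Y p.1 p.2)
    (fun p => hYW _ _) (by simp; omega)
  have hsing : ∀ F : Matrix (Fin 2) (Fin 2) ℂ, ∑ i, ∑ k, F i k • Y i k = 0 → F.det = 0 →
      F = 0 := by
    intro F hF hdet
    by_contra hF0
    exact hred ((reducible_of_singular_relation hF0 hdet hF).blockDiagonalizable hY)
  let F : Matrix (Fin 2) (Fin 2) ℂ := of fun i k => g (i, k)
  have hF : ∑ i, ∑ k, F i k • Y i k = 0 := by
    rw [Fintype.sum_prod_type] at hg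
    exact hg
  have hF0 : F ≠ 0 := fun h => hg0 (by
    ext ⟨i, k⟩
    exact congrFun (congrFun h i) k)
  have hdet : F.det ≠ 0 := fun h => hF0 (hsing F hF h)
  obtain ⟨t, ht⟩ := exists_det_add_smul_eq_zero F.adjugateᴴ hdet
  have hzero : F.adjugateᴴ + t • F = 0 := by
    refine hsing _ ?_ ht
    have h1 : ∑ i, ∑ k, (F.adjugateᴴ + t • F) i k • Y i k =
        ∑ i, ∑ k, F.adjugateᴴ i k • Y i k + t • ∑ i, ∑ k, F i k • Y i k := by
      simp only [Matrix.add_apply, Matrix.smul_apply, add_smul, Finset.sum_add_distrib,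
        Finset.smul_sum, smul_smul, smul_eq_mul]
    rw [h1, conj_relation hY hF, hF, smul_zero, add_zero]
  obtain ⟨c, hc⟩ := exists_smul_mem_unitary_of_adjugate hdet hzero
  refine ⟨_, hc, eq_neg_of_add_eq_zero_right ?_⟩
  have h2 : (scalarBlocks b (c • Fᵀ) * Y * scalarBlocks b (1 : Matrix (Fin 2) (Fin 2) ℂ)) 0 0 +
      (scalarBlocks b (c • Fᵀ) * Y * scalarBlocks b (1 : Matrix (Fin 2) (Fin 2) ℂ)) 1 1 =
        c • ∑ i, ∑ k, F i k • Y i k := by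
    simp only [scalarBlocks_mul_mul_apply, Fin.sum_univ_two, Matrix.smul_apply, transpose_apply,
      smul_eq_mul, one_apply_eq, one_apply_ne, ne_eq, zero_ne_one, one_ne_zero,
      not_false_eq_true, mul_one, mul_zero, zero_smul, smul_add, smul_smul]
    abel
  rw [h2, hF, smul_zero]

theorem Reducible.hasCommProducts_or_blockDiagonalizable
    {X : Matrix (Fin 3) (Fin 3) (Matrix b b ℂ)} (h : Reducible X)
    (hX : X ∈ unitary (Matrix (Fin 3) (Fin 3) (Matrix b b ℂ)))
    {W : Submodule ℂ (Matrix b b ℂ)} (hW : Module.finrank ℂ W ≤ 3) (hXW : ∀ i k, X i k ∈ W) :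
    HasCommProducts X ∨ BlockDiagonalizable X := by
  obtain ⟨P, hP, R, hR, hcol, hrow⟩ := h.exists_split hX 0
  have hZu : scalarBlocks b P * X * scalarBlocks b R ∈
      unitary (Matrix (Fin 3) (Fin 3) (Matrix b b ℂ)) :=
    mul_mem (mul_mem (scalarBlocks_mem_unitary hP) hX) (scalarBlocks_mem_unitary hR)
  have hZW := fun i k => scalarBlocks_mul_mul_mem (P := P) (R := R) hXW i k
  refine Or.imp (HasCommProducts.of_conj hP hR) (BlockDiagonalizable.of_conj hP hR) ?_
  set Z := scalarBlocks b P * X * scalarBlocks b R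
  clear_value Z
  have hYu := submatrix_succ_mem_unitary hZu hcol hrow
  by_cases hred : BlockDiagonalizable (Z.submatrix Fin.succ Fin.succ)
  · exact Or.inr (hred.extendOne hcol hrow)
  left
  have hYW : ∀ i k, Z.submatrix Fin.succ Fin.succ i k ∈ W := fun i k => hZW _ _
  obtain ⟨Q, hQ, hQ1⟩ := exists_traceless_form hYu hred hW hYW
  have hY'W := fun i k => scalarBlocks_mul_mul_mem (P := Q) (R := 1) hYW i k
  have hred' : ¬ BlockDiagonalizable
      (scalarBlocks b Q * Z.submatrix Fin.succ Fin.succ *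
        scalarBlocks b (1 : Matrix (Fin 2) (Fin 2) ℂ)) :=
    fun h => hred (h.of_conj hQ (one_mem _))
  have hY'u : scalarBlocks b Q * Z.submatrix Fin.succ Fin.succ *
      scalarBlocks b (1 : Matrix (Fin 2) (Fin 2) ℂ) ∈
      unitary (Matrix (Fin 2) (Fin 2) (Matrix b b ℂ)) :=
    mul_mem (mul_mem (scalarBlocks_mem_unitary hQ) hYu) (scalarBlocks_mem_unitary (one_mem _))
  -- Prepared while `Y` is still expanded: membership of the normalized blocks in a span passes back
  -- to the original ones.
  have hYmem := fun (T : Set (Matrix b b ℂ)) hT (i k : Fin 2) =>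
    (congrFun (congrFun (scalarBlocks_conj_cancel hQ (one_mem _)
      (Z.submatrix Fin.succ Fin.succ)) i) k) ▸
      scalarBlocks_mul_mul_mem (P := star Q) (R := star 1) (W := Submodule.span ℂ T) hT i k
  set Y := scalarBlocks b Q * Z.submatrix Fin.succ Fin.succ *
    scalarBlocks b (1 : Matrix (Fin 2) (Fin 2) ℂ)
  clear_value Y
  have hcom : CommProducts {Y 0 0, Y 0 1, Y 1 0} := by
    have hc := mul_apply_eq_of_isometry hY'u
    have hr := mul_apply_eq_of_coisometry hY'u
    simp only [Fin.sum_univ_two] at hc hr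
    have h1 := hc 0 0
    have h2 := hc 1 1
    have h3 := hc 0 1
    have h4 := hr 0 0
    have h5 := hr 1 1
    have h6 := hr 0 1
    simp only [hQ1, if_true, zero_ne_one, if_false, conjTranspose_neg, mul_neg, neg_mul,
      neg_neg] at h1 h2 h3 h4 h5 h6
    refine commProducts_of_traceless_unitary h1 h2 ?_ h4 h5 ?_
    · exact add_neg_eq_zero.mp h3
    · exact add_neg_eq_zero.mp h6
  have hYT : ∀ i k, Y i k ∈ Submodule.span ℂ {Y 0 0, Y 0 1, Y 1 0} := by
    intro i k
    fin_cases i <;> fin_cases k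
    · exact Submodule.subset_span (by simp)
    · exact Submodule.subset_span (by simp)
    · exact Submodule.subset_span (by simp)
    · show Y 1 1 ∈ _
      rw [hQ1]
      exact Submodule.neg_mem _ (Submodule.subset_span (by simp))
  -- A relation among `Y 0 0`, `Y 0 1`, `Y 1 0`, `Z 0 0` exists because dim W ≤ 3; it must involve
  -- `Z 0 0`, since the first three are independent.
  have hV : Z 0 0 ∈ Submodule.span ℂ {Y 0 0, Y 0 1, Y 1 0} := by
    obtain ⟨g, hg, hg0⟩ := exists_linear_relation W ![Y 0 0, Y 0 1, Y 1 0, Z 0 0]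
      (by
        intro i
        fin_cases i
        exacts [hY'W 0 0, hY'W 0 1, hY'W 1 0, hZW 0 0])
      (by simp; omega)
    simp only [Fin.sum_univ_four, cons_val_zero, cons_val_one, cons_val] at hg
    by_cases h3 : g 3 = 0
    · exfalso
      rw [h3, zero_smul, add_zero] at hg
      let F : Matrix (Fin 2) (Fin 2) ℂ := !![g 0, g 1; g 2, 0]
      -- Adding t(Y₀₀ + Y₁₁) = 0 keeps the relation valid, so t can be chosen to make it singular.
      obtain ⟨t, ht⟩ := exists_det_add_smul_eq_zero F (G := 1) (by simp)
      refine hred' ((reducible_of_singular_relation (F := F + t • 1) ?_ ht ?_).blockDiagonalizable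
        hY'u)
      · intro h0
        have e00 := congrFun (congrFun h0 0) 0
        have e01 := congrFun (congrFun h0 0) 1
        have e10 := congrFun (congrFun h0 1) 0
        have e11 := congrFun (congrFun h0 1) 1
        simp [F] at e00 e01 e10 e11
        apply hg0
        ext i
        fin_cases i
        · simpa [e11] using e00
        · exact e01
        · exact e10
        · exact h3
      · simp only [Fin.sum_univ_two, F, Matrix.add_apply, Matrix.smul_apply, of_apply, cons_val',
          cons_val_zero, cons_val_one, cons_val_fin_one, one_apply_eq, one_apply_ne, ne_eq,
          zero_ne_one, one_ne_zero, not_false_eq_true, smul_eq_mul, mul_one, mul_zero, add_zero,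
          zero_add, hQ1]
        rw [← hg]
        module
    · have : Z 0 0 = (-(g 3)⁻¹) • (g 0 • Y 0 0 + g 1 • Y 0 1 + g 2 • Y 1 0) := by
        rw [eq_neg_of_add_eq_zero_left hg, smul_neg, neg_smul, neg_neg, smul_smul,
          inv_mul_cancel₀ h3, one_smul]
      rw [this]
      refine Submodule.smul_mem _ _ (Submodule.add_mem _ (Submodule.add_mem _ ?_ ?_) ?_) <;>
        exact Submodule.smul_mem _ _ (Submodule.subset_span (by simp))
  refine ⟨_, hcom, fun i k => ?_⟩
  induction i using Fin.cases with
  | zero =>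
    induction k using Fin.cases with
    | zero => exact hV
    | succ k => rw [hrow _ (Fin.succ_ne_zero k)]; exact Submodule.zero_mem _
  | succ i =>
    induction k using Fin.cases with
    | zero => rw [hcol _ (Fin.succ_ne_zero i)]; exact Submodule.zero_mem _
    | succ k => exact hYmem _ hYT i k

end TwoByTwo

/-! ### Two columns proportional row by row. -/

section ProportionalColumns

set_option linter.unusedSectionVars false

variable {b : Type*} [Fintype b] [DecidableEq b]

theorem mul_eq_zero_of_normal {N M : Matrix b b ℂ} (hN : Commute Nᴴ N) (hM : Commute Mᴴ M)
    (h : N * M = 0) : M * N = 0 := by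
  have h1 : Nᴴ * M = 0 := by
    rw [← conjTranspose_mul_self_eq_zero]
    calc (Nᴴ * M)ᴴ * (Nᴴ * M) = Mᴴ * (N * Nᴴ) * M := by
          simp only [conjTranspose_mul, conjTranspose_conjTranspose, mul_assoc]
      _ = Mᴴ * Nᴴ * (N * M) := by rw [← hN.eq]; simp only [mul_assoc]
      _ = 0 := by rw [h, mul_zero]
  have h2 : Mᴴ * N = 0 := by simpa using congrArg conjTranspose h1
  rw [← conjTranspose_mul_self_eq_zero]
  calc (M * N)ᴴ * (M * N) = Nᴴ * (Mᴴ * M) * N := by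
        simp only [conjTranspose_mul, mul_assoc]
    _ = Nᴴ * M * (Mᴴ * N) := by rw [hM.eq]; simp only [mul_assoc]
    _ = 0 := by rw [h2, mul_zero]

theorem commute_sub_smul_one_normal {H : Matrix b b ℂ} (hH : Commute Hᴴ H) (z : ℂ) :
    Commute (H - z • (1 : Matrix b b ℂ))ᴴ (H - z • (1 : Matrix b b ℂ)) := by
  rw [conjTranspose_sub, conjTranspose_smul, conjTranspose_one]
  refine Commute.sub_left (Commute.sub_right hH ?_) ?_
  · exact (Commute.one_right _).smul_right _
  · exact (Commute.one_left _).smul_left _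

/-- Without the product term, one matrix is affine in the other or scalar. With it, the relation
factors as (H − z)(G − y) = w: for w ≠ 0 the factors are inverse up to scaling, and for w = 0 they
are normal with product zero, so the reversed product also vanishes. -/
theorem commute_of_linear_relation [Nonempty b] {H G : Matrix b b ℂ} (hH : Commute Hᴴ H)
    (hG : Commute Gᴴ G) {g : Fin 4 → ℂ} (hg : g ≠ 0)
    (h : g 0 • (1 : Matrix b b ℂ) + g 1 • H + g 2 • G + g 3 • (H * G) = 0) : Commute H G := by
  by_cases h3 : g 3 = 0
  · rw [h3, zero_smul, add_zero] at h
    by_cases h1 : g 1 = 0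
    · by_cases h2 : g 2 = 0
      · rw [h1, h2, zero_smul, zero_smul, add_zero, add_zero] at h
        have h0 : g 0 = 0 := (smul_eq_zero_iff_left one_ne_zero).mp h
        exact absurd (by ext i; fin_cases i <;> assumption) hg
      · have : G = (-(g 2)⁻¹ * g 0) • (1 : Matrix b b ℂ) := by
          rw [h1, zero_smul, add_zero] at h
          rw [mul_smul, eq_neg_of_add_eq_zero_left h, smul_neg, neg_smul, neg_neg, smul_smul,
            inv_mul_cancel₀ h2, one_smul]
        rw [this]
        exact (Commute.one_right _).smul_right _
    · have h' : g 1 • H + (g 0 • (1 : Matrix b b ℂ) + g 2 • G) = 0 := by rw [← h]; abel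
      have : H = (-(g 1)⁻¹) • (g 0 • (1 : Matrix b b ℂ) + g 2 • G) := by
        rw [eq_neg_of_add_eq_zero_right h', smul_neg, neg_smul, neg_neg, smul_smul,
          inv_mul_cancel₀ h1, one_smul]
      rw [this]
      exact (((Commute.one_left _).smul_left _).add_left ((Commute.refl _).smul_left _)).smul_left _
  · set z := -g 2 / g 3
    set y := -g 1 / g 3
    set w := z * y - g 0 / g 3
    have hprod : (H - z • (1 : Matrix b b ℂ)) * (G - y • (1 : Matrix b b ℂ)) =
        w • (1 : Matrix b b ℂ) := by
      have h4 : (H - z • (1 : Matrix b b ℂ)) * (G - y • (1 : Matrix b b ℂ)) -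
          w • (1 : Matrix b b ℂ) = (g 3)⁻¹ •
            (g 0 • (1 : Matrix b b ℂ) + g 1 • H + g 2 • G + g 3 • (H * G)) := by
        simp only [sub_mul, mul_sub, smul_mul_assoc, mul_smul_comm, one_mul, mul_one, smul_add,
          smul_smul, inv_mul_cancel₀ h3, one_smul, w, z, y]
        module
      rw [h, smul_zero] at h4
      exact sub_eq_zero.mp h4
    have hcomm : (G - y • (1 : Matrix b b ℂ)) * (H - z • (1 : Matrix b b ℂ)) =
        w • (1 : Matrix b b ℂ) := by
      by_cases hw : w = 0
      · rw [hw, zero_smul] at hprod ⊢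
        exact mul_eq_zero_of_normal (commute_sub_smul_one_normal hH z)
          (commute_sub_smul_one_normal hG y) hprod
      · have h5 : (H - z • (1 : Matrix b b ℂ)) * (w⁻¹ • (G - y • (1 : Matrix b b ℂ))) = 1 := by
          rw [mul_smul_comm, hprod, smul_smul, inv_mul_cancel₀ hw, one_smul]
        have h6 := mul_eq_one_comm.mp h5
        rw [smul_mul_assoc] at h6
        exact (inv_smul_eq_iff₀ hw).mp h6
    have h7 : Commute (H - z • (1 : Matrix b b ℂ)) (G - y • (1 : Matrix b b ℂ)) :=
      hprod.trans hcomm.symm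
    have h8 := (h7.add_left ((Commute.one_left (G - y • (1 : Matrix b b ℂ))).smul_left z)).add_right
      ((Commute.one_right _).smul_right y)
    simpa using h8

theorem mul_conjTranspose_eq_smul_one {B : Matrix b b ℂ} {p : ℂ}
    (h : Bᴴ * B = p • (1 : Matrix b b ℂ)) (hp : p ≠ 0) : B * Bᴴ = p • (1 : Matrix b b ℂ) := by
  have h1 : (p⁻¹ • Bᴴ) * B = 1 := by
    rw [smul_mul_assoc, h, smul_smul, inv_mul_cancel₀ hp, one_smul]
  have h2 := mul_eq_one_comm.mp h1
  rw [mul_smul_comm] at h2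
  rw [← h2, smul_smul, mul_inv_cancel₀ hp, one_smul]

/-- Here Gᴴ is a multiple of G⁻¹. -/
theorem commute_conjTranspose_right {H G : Matrix b b ℂ} {p : ℂ} (h : Commute H G)
    (hG : Gᴴ * G = p • (1 : Matrix b b ℂ)) (hp : p ≠ 0) : Commute H Gᴴ := by
  have hG' := mul_conjTranspose_eq_smul_one hG hp
  have h1 : p • (H * Gᴴ) = p • (Gᴴ * H) := by
    calc p • (H * Gᴴ) = Gᴴ * G * (H * Gᴴ) := by rw [hG, smul_mul_assoc, one_mul]
      _ = Gᴴ * (G * H) * Gᴴ := by simp only [mul_assoc]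
      _ = Gᴴ * H * (G * Gᴴ) := by rw [← h.eq]; simp only [mul_assoc]
      _ = p • (Gᴴ * H) := by rw [hG', mul_smul_comm, mul_one]
  exact smul_right_injective _ hp h1

/-- Since (Bx)ᴴ(By) = p·xᴴy, the products stay, up to scalars, in a commutative star algebra. -/
theorem commProducts_image {B : Matrix b b ℂ} {p : ℂ} (hB : Bᴴ * B = p • (1 : Matrix b b ℂ))
    {s : Set (Matrix b b ℂ)} (h1 : ∀ x ∈ s, ∀ y ∈ s, x * y = y * x)
    (h2 : ∀ x ∈ s, ∀ y ∈ s, x * star y = star y * x) :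
    CommProducts ((B * ·) '' (StarAlgebra.adjoin ℂ s : Set (Matrix b b ℂ))) := by
  have hc := StarAlgebra.isMulCommutative_adjoin ℂ h1 h2
  rintro _ ⟨x, hx, rfl⟩ _ ⟨y, hy, rfl⟩ _ ⟨z, hz, rfl⟩ _ ⟨w, hw, rfl⟩
  have key : ∀ x y : Matrix b b ℂ, (B * x)ᴴ * (B * y) = p • (xᴴ * y) := by
    intro x y
    calc (B * x)ᴴ * (B * y) = xᴴ * (Bᴴ * B) * y := by simp only [conjTranspose_mul, mul_assoc]
      _ = _ := by rw [hB, mul_smul_comm, mul_one, smul_mul_assoc]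
  simp only [key]
  refine (Commute.smul_left ?_ _).smul_right _
  have hm1 := mul_mem (star_mem hx) hy
  have hm2 := mul_mem (star_mem hz) hw
  exact congrArg Subtype.val (hc.is_comm.comm ⟨_, hm1⟩ ⟨_, hm2⟩)

/-- The combination ωᵢ·(column 0) − (column 1) vanishes in rows i and j, so it is supported on a
single row. -/
theorem reducible_of_eq {X : Matrix (Fin 3) (Fin 3) (Matrix b b ℂ)} {ω : Fin 3 → ℂ}
    (hω : ∀ i, X i 1 = ω i • X i 0) {i j : Fin 3} (hij : i ≠ j) (h : ω i = ω j) :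
    Reducible X := by
  obtain ⟨k, hk⟩ : ∃ k, ∀ l, l ≠ k → l = i ∨ l = j := by
    clear h hω
    decide +revert
  refine ⟨![ω i, -1, 0], fun h0 => ?_, fun l => ω i - ω l, X k 0, fun l => ?_⟩
  · simpa using congrFun h0 1
  · have h1 : ∑ m, (![ω i, -1, 0] : Fin 3 → ℂ) m • X l m = (ω i - ω l) • X l 0 := by
      simp only [Fin.sum_univ_three, hω l, cons_val_zero, cons_val_one, cons_val]
      module
    rw [h1]
    beta_reduce
    by_cases hl : l = k
    · rw [hl]
    · have : ω i - ω l = 0 := by rcases hk l hl with rfl | rfl <;> simp [h]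
      rw [this, zero_smul, zero_smul]

/-- On the unit circle, w − (wⱼ + wₖ) + wⱼwₖ·w̄ equals w̄(w − wⱼ)(w − wₖ), so this combination of
the three relations eliminates `Ej` and `Ek`. -/
theorem smul_gram_eq {wi wj wk : ℂ} (hi : wi * star wi = 1) (hj : wj * star wj = 1)
    (hk : wk * star wk = 1) {Ei Ej Ek : Matrix b b ℂ} (h1 : Ei + Ej + Ek = 1)
    (h2 : wi • Ei + wj • Ej + wk • Ek = 0)
    (h3 : star wi • Ei + star wj • Ej + star wk • Ek = 0) :
    (star wi * ((wi - wj) * (wi - wk))) • Ei = (-(wj + wk)) • (1 : Matrix b b ℂ) := by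
  have h4 : (wi - wj - wk + wj * wk * star wi) • Ei +
      (wj - wj - wk + wj * wk * star wj) • Ej +
      (wk - wj - wk + wj * wk * star wk) • Ek = (-(wj + wk)) • (1 : Matrix b b ℂ) := by
    calc _ = (wi • Ei + wj • Ej + wk • Ek) + (-(wj + wk)) • (Ei + Ej + Ek) +
          (wj * wk) • (star wi • Ei + star wj • Ej + star wk • Ek) := by module
      _ = _ := by rw [h1, h2, h3, smul_zero, zero_add, add_zero]
  have e1 : wj - wj - wk + wj * wk * star wj = 0 := by linear_combination wk * hj
  have e2 : wk - wj - wk + wj * wk * star wk = 0 := by linear_combination wj * hk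
  have e3 : wi - wj - wk + wj * wk * star wi = star wi * ((wi - wj) * (wi - wk)) := by
    linear_combination -(wi - wj - wk) * hi
  rwa [e1, e2, e3, zero_smul, zero_smul, add_zero, add_zero] at h4

theorem sum_univ_of_distinct {M : Type*} [AddCommMonoid M] (f : Fin 3 → M) {i j k : Fin 3}
    (hij : i ≠ j) (hik : i ≠ k) (hjk : j ≠ k) : ∑ l, f l = f i + f j + f k := by
  have : (Finset.univ : Finset (Fin 3)) = {i, j, k} := by decide +revert
  rw [this, Finset.sum_insert (by simp [hij, hik]), Finset.sum_insert (by simp [hjk]),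
    Finset.sum_singleton, add_assoc]

/-- The only remaining block of row i is unitary, so row orthogonality clears the rest of column 2.
-/
theorem reducible_of_row {X : Matrix (Fin 3) (Fin 3) (Matrix b b ℂ)}
    (hX : X ∈ unitary (Matrix (Fin 3) (Fin 3) (Matrix b b ℂ))) {i : Fin 3} (h0 : X i 0 = 0)
    (h1 : X i 1 = 0) : Reducible X := by
  have hr := mul_apply_eq_of_coisometry hX
  simp only [Fin.sum_univ_three] at hr
  have hii := hr i i
  simp only [h0, h1, zero_mul, zero_add, if_true] at hii
  refine ⟨Pi.single 2 1, by simp, Pi.single i 1, X i 2, fun l => ?_⟩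
  rw [Finset.sum_eq_single 2 (fun k _ hk => by simp [hk]) (by simp), Pi.single_eq_same, one_smul]
  by_cases hl : l = i
  · rw [hl, Pi.single_eq_same, one_smul]
  · rw [Pi.single_eq_of_ne hl, zero_smul]
    have hil := hr i l
    simp only [h0, h1, zero_mul, zero_add, if_neg (Ne.symm hl)] at hil
    rw [← conjTranspose_eq_zero]
    calc (X l 2)ᴴ = ((X i 2)ᴴ * X i 2) * (X l 2)ᴴ := by rw [mul_eq_one_comm.mp hii, one_mul]
      _ = 0 := by rw [mul_assoc, hil, mul_zero]

/-- The coefficients are the cross product of (1, ω₀, g₀) and (1, ω₁, g₁), so the combined column is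
supported on row 2. -/
theorem reducible_of_proportional {X : Matrix (Fin 3) (Fin 3) (Matrix b b ℂ)} {ω g : Fin 3 → ℂ}
    (hω : ∀ i, X i 1 = ω i • X i 0) (hg : ∀ i, X i 2 = g i • X i 0) (h01 : ω 0 ≠ ω 1) :
    Reducible X := by
  refine ⟨![ω 0 * g 1 - g 0 * ω 1, g 0 - g 1, ω 1 - ω 0], fun h0 => ?_,
    fun l => ω 0 * g 1 - g 0 * ω 1 + (g 0 - g 1) * ω l + (ω 1 - ω 0) * g l, X 2 0, fun l => ?_⟩
  · have := congrFun h0 2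
    simp only [cons_val, Pi.zero_apply] at this
    exact h01 (sub_eq_zero.mp this).symm
  · have h1 : ∑ m, (![ω 0 * g 1 - g 0 * ω 1, g 0 - g 1, ω 1 - ω 0] : Fin 3 → ℂ) m • X l m =
        (ω 0 * g 1 - g 0 * ω 1 + (g 0 - g 1) * ω l + (ω 1 - ω 0) * g l) • X l 0 := by
      simp only [Fin.sum_univ_three, hω l, hg l, cons_val_zero, cons_val_one, cons_val]
      module
    rw [h1]
    beta_reduce
    fin_cases l
    · have : ω 0 * g 1 - g 0 * ω 1 + (g 0 - g 1) * ω 0 + (ω 1 - ω 0) * g 0 = 0 := by ring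
      simp only [Fin.zero_eta, this, zero_smul]
    · have : ω 0 * g 1 - g 0 * ω 1 + (g 0 - g 1) * ω 1 + (ω 1 - ω 0) * g 1 = 0 := by ring
      simp only [Fin.mk_one, this, zero_smul]
    · rfl

/-- If `B i` and `B i * G` lie in a three-dimensional space, where the `B i` and `G` are nonzero
multiples of unitary matrices, then `G` is scalar or all products commute. -/
theorem scalar_or_hasCommProducts [Nonempty b] {X : Matrix (Fin 3) (Fin 3) (Matrix b b ℂ)}
    {W : Submodule ℂ (Matrix b b ℂ)} (hW : Module.finrank ℂ W ≤ 3) {B : Fin 3 → Matrix b b ℂ}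
    {G : Matrix b b ℂ} {p : Fin 3 → ℂ} {q : ℂ} (hp : ∀ i, p i ≠ 0) (hq : q ≠ 0)
    (hB : ∀ i, (B i)ᴴ * B i = p i • (1 : Matrix b b ℂ)) (hG : Gᴴ * G = q • (1 : Matrix b b ℂ))
    (hBW : ∀ i, B i ∈ W) (hBGW : ∀ i, B i * G ∈ W)
    (hX : ∀ i k, X i k ∈ Submodule.span ℂ {B i, B i * G}) :
    (∃ t : ℂ, G = t • (1 : Matrix b b ℂ)) ∨ HasCommProducts X := by
  have hB' := fun i => mul_conjTranspose_eq_smul_one (hB i) (hp i)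
  have hG' := mul_conjTranspose_eq_smul_one hG hq
  have hGn : Commute Gᴴ G := hG.trans hG'.symm
  let H : Fin 3 → Matrix b b ℂ := fun i => (B 0)ᴴ * B i
  have hH : ∀ i, (H i)ᴴ * H i = (p 0 * p i) • (1 : Matrix b b ℂ) := by
    intro i
    calc (H i)ᴴ * H i = (B i)ᴴ * (B 0 * (B 0)ᴴ) * B i := by
          simp only [H, conjTranspose_mul, conjTranspose_conjTranspose, mul_assoc]
      _ = _ := by rw [hB', mul_smul_comm, mul_one, smul_mul_assoc, hB, smul_smul]
  have hp2 : ∀ i, p 0 * p i ≠ 0 := fun i => mul_ne_zero (hp 0) (hp i)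
  have hHn : ∀ i, Commute (H i)ᴴ (H i) := fun i =>
    (hH i).trans (mul_conjTranspose_eq_smul_one (hH i) (hp2 i)).symm
  -- The matrices B₀, Bᵢ, B₀G, BᵢG are dependent in W; multiplying by B₀ᴴ gives a relation among 1,
  -- Hᵢ, G, HᵢG.
  have hHG : ∀ i, Commute (H i) G := by
    intro i
    obtain ⟨g, hg, hg0⟩ := exists_linear_relation W ![B 0, B i, B 0 * G, B i * G]
      (by
        intro l
        fin_cases l
        exacts [hBW 0, hBW i, hBGW 0, hBGW i])
      (by simp; omega)
    simp only [Fin.sum_univ_four, cons_val_zero, cons_val_one, cons_val] at hg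
    have h1 := congrArg ((B 0)ᴴ * ·) hg
    simp only [mul_add, mul_smul_comm, ← mul_assoc, hB, smul_mul_assoc, one_mul, mul_zero,
      smul_smul] at h1
    refine commute_of_linear_relation (g := ![g 0 * p 0, g 1, g 2 * p 0, g 3]) (hHn i) hGn ?_ h1
    intro h0
    apply hg0
    ext l
    fin_cases l
    · exact (mul_eq_zero_iff_right (hp 0)).mp (congrFun h0 0)
    · exact congrFun h0 1
    · exact (mul_eq_zero_iff_right (hp 0)).mp (congrFun h0 2)
    · exact congrFun h0 3
  by_cases hscal : ∃ t : ℂ, G = t • (1 : Matrix b b ℂ)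
  · exact Or.inl hscal
  right
  -- Dependence of B₀, B₁, B₂, B₀G relates 1, H₁, H₂, G. As `G` is not scalar, H₁ or H₂ occurs and
  -- can be solved for.
  have h12 : Commute (H 1) (H 2) := by
    obtain ⟨g, hg, hg0⟩ := exists_linear_relation W ![B 0, B 1, B 2, B 0 * G]
      (by
        intro l
        fin_cases l
        exacts [hBW 0, hBW 1, hBW 2, hBGW 0])
      (by simp; omega)
    simp only [Fin.sum_univ_four, cons_val_zero, cons_val_one, cons_val] at hg
    have h1 := congrArg ((B 0)ᴴ * ·) hg
    simp only [mul_add, mul_smul_comm, ← mul_assoc, hB, smul_mul_assoc, one_mul, mul_zero,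
      smul_smul] at h1
    change (g 0 * p 0) • (1 : Matrix b b ℂ) + g 1 • H 1 + g 2 • H 2 + (g 3 * p 0) • G = 0 at h1
    by_cases g1 : g 1 = 0
    · by_cases g2 : g 2 = 0
      · exfalso
        rw [g1, g2, zero_smul, zero_smul, add_zero, add_zero] at h1
        by_cases g3 : g 3 = 0
        · rw [g3, zero_mul, zero_smul, add_zero, smul_eq_zero_iff_left one_ne_zero] at h1
          apply hg0
          ext l
          fin_cases l
          · exact (mul_eq_zero_iff_right (hp 0)).mp h1
          · exact g1
          · exact g2
          · exact g3
        · refine hscal ⟨-(g 3 * p 0)⁻¹ * (g 0 * p 0), ?_⟩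
          rw [mul_smul, eq_neg_of_add_eq_zero_left h1, smul_neg, neg_smul, neg_neg, smul_smul,
            inv_mul_cancel₀ (mul_ne_zero g3 (hp 0)), one_smul]
      · have h2 : H 2 = (-(g 2)⁻¹) •
            ((g 0 * p 0) • (1 : Matrix b b ℂ) + g 1 • H 1 + (g 3 * p 0) • G) := by
          have h3 : g 2 • H 2 + ((g 0 * p 0) • (1 : Matrix b b ℂ) + g 1 • H 1 +
              (g 3 * p 0) • G) = 0 := by rw [← h1]; abel
          rw [eq_neg_of_add_eq_zero_right h3, smul_neg, neg_smul, neg_neg, smul_smul,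
            inv_mul_cancel₀ g2, one_smul]
        rw [h2]
        exact ((((Commute.one_right _).smul_right _).add_right
          ((Commute.refl _).smul_right _)).add_right ((hHG 1).smul_right _)).smul_right _
    · have h2 : H 1 = (-(g 1)⁻¹) •
          ((g 0 * p 0) • (1 : Matrix b b ℂ) + g 2 • H 2 + (g 3 * p 0) • G) := by
        have h3 : g 1 • H 1 + ((g 0 * p 0) • (1 : Matrix b b ℂ) + g 2 • H 2 +
            (g 3 * p 0) • G) = 0 := by rw [← h1]; abel
        rw [eq_neg_of_add_eq_zero_right h3, smul_neg, neg_smul, neg_neg, smul_smul,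
          inv_mul_cancel₀ g1, one_smul]
      rw [h2]
      exact ((((Commute.one_left _).smul_left _).add_left
        ((Commute.refl _).smul_left _)).add_left ((hHG 2).symm.smul_left _)).smul_left _
  let s : Set (Matrix b b ℂ) := {H 1, H 2, G}
  have hs : ∀ x ∈ s, ∃ r : ℂ, r ≠ 0 ∧ xᴴ * x = r • (1 : Matrix b b ℂ) := by
    rintro x (rfl | rfl | rfl)
    exacts [⟨_, hp2 1, hH 1⟩, ⟨_, hp2 2, hH 2⟩, ⟨q, hq, hG⟩]
  have hs1 : ∀ x ∈ s, ∀ y ∈ s, Commute x y := by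
    rintro x (rfl | rfl | rfl) y (rfl | rfl | rfl)
    exacts [Commute.refl _, h12, hHG 1, h12.symm, Commute.refl _, hHG 2, (hHG 1).symm,
      (hHG 2).symm, Commute.refl _]
  have hcom := commProducts_image (hB 0) (s := s) (fun x hx y hy => (hs1 x hx y hy).eq)
    (fun x hx y hy => by
      obtain ⟨r, hr, hyr⟩ := hs y hy
      exact (commute_conjTranspose_right (hs1 x hx y hy) hyr hr).eq)
  have hHs : ∀ i, H i ∈ StarAlgebra.adjoin ℂ s := by
    intro i
    fin_cases i
    · show H 0 ∈ _
      have : H 0 = p 0 • (1 : Matrix b b ℂ) := hB 0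
      rw [this]
      exact SMulMemClass.smul_mem _ (one_mem _)
    · exact StarAlgebra.subset_adjoin ℂ s (by simp [s])
    · exact StarAlgebra.subset_adjoin ℂ s (by simp [s])
  have hGs : G ∈ StarAlgebra.adjoin ℂ s := StarAlgebra.subset_adjoin ℂ s (by simp [s])
  have hBH : ∀ i, B i = B 0 * ((p 0)⁻¹ • H i) := by
    intro i
    rw [mul_smul_comm, ← mul_assoc, hB' 0, smul_mul_assoc, one_mul, smul_smul,
      inv_mul_cancel₀ (hp 0), one_smul]
  refine ⟨_, hcom, fun i k => ?_⟩
  refine Submodule.span_mono ?_ (hX i k)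
  have hm : (p 0)⁻¹ • H i ∈ StarAlgebra.adjoin ℂ s := SMulMemClass.smul_mem _ (hHs i)
  rintro x (rfl | rfl)
  · exact ⟨_, hm, (hBH i).symm⟩
  · refine ⟨_, mul_mem hm hGs, ?_⟩
    show B 0 * (((p 0)⁻¹ • H i) * G) = B i * G
    rw [← mul_assoc, ← hBH]

/-- For distinct ωᵢ, column orthonormality determines the matrices (X i 0)ᴴ X i 0 as scalars, and
row orthogonality then expresses column 2 through column 0 and a single matrix `G`. -/
theorem reducible_or_hasCommProducts_of_column [Nonempty b]
    {X : Matrix (Fin 3) (Fin 3) (Matrix b b ℂ)}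
    (hX : X ∈ unitary (Matrix (Fin 3) (Fin 3) (Matrix b b ℂ)))
    {W : Submodule ℂ (Matrix b b ℂ)} (hW : Module.finrank ℂ W ≤ 3) (hXW : ∀ i k, X i k ∈ W)
    {ω : Fin 3 → ℂ} (hω1 : ∀ i, ω i * star (ω i) = 1) (hω : ∀ i, X i 1 = ω i • X i 0) :
    Reducible X ∨ HasCommProducts X := by
  by_cases hinj : Function.Injective ω
  swap
  · rw [Function.not_injective_iff] at hinj
    obtain ⟨i, j, h, hij⟩ := hinj
    exact Or.inl (reducible_of_eq hω hij h)
  have hω0 : ∀ i, ω i ≠ 0 := fun i h => by simpa [h] using hω1 i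
  have hc := mul_apply_eq_of_isometry hX
  have hr := mul_apply_eq_of_coisometry hX
  have hgram : ∀ i j k, i ≠ j → i ≠ k → j ≠ k →
      (star (ω i) * ((ω i - ω j) * (ω i - ω k))) • ((X i 0)ᴴ * X i 0) =
        (-(ω j + ω k)) • (1 : Matrix b b ℂ) := by
    intro i j k hij hik hjk
    refine smul_gram_eq (hω1 i) (hω1 j) (hω1 k) (Ej := (X j 0)ᴴ * X j 0)
      (Ek := (X k 0)ᴴ * X k 0) ?_ ?_ ?_
    · rw [← sum_univ_of_distinct (fun l => (X l 0)ᴴ * X l 0) hij hik hjk, hc, if_pos rfl]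
    · have := hc 0 1
      rw [sum_univ_of_distinct _ hij hik hjk] at this
      simpa [hω] using this
    · have := hc 1 0
      rw [sum_univ_of_distinct _ hij hik hjk] at this
      simpa [hω] using this
  have hcoef : ∀ i j k, i ≠ j → i ≠ k → star (ω i) * ((ω i - ω j) * (ω i - ω k)) ≠ 0 := by
    intro i j k hij hik
    exact mul_ne_zero (star_ne_zero.mpr (hω0 i))
      (mul_ne_zero (sub_ne_zero.mpr (hinj.ne hij)) (sub_ne_zero.mpr (hinj.ne hik)))
  have hthird : ∀ j k : Fin 3, j ≠ k → ∃ i, i ≠ j ∧ i ≠ k := by decide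
  have hpair : ∀ i : Fin 3, ∃ j k : Fin 3, i ≠ j ∧ i ≠ k ∧ j ≠ k := by decide
  -- A vanishing sum ωⱼ + ωₖ is exactly the case in which the scalar (X i 0)ᴴ X i 0 of the third row
  -- is zero.
  by_cases hsum : ∃ j k, j ≠ k ∧ ω j + ω k = 0
  · left
    obtain ⟨j, k, hjk, h0⟩ := hsum
    obtain ⟨i, hij, hik⟩ := hthird j k hjk
    have h1 := hgram i j k hij hik hjk
    rw [h0, neg_zero, zero_smul, smul_eq_zero_iff_right (hcoef i j k hij hik),
      conjTranspose_mul_self_eq_zero] at h1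
    exact reducible_of_row hX h1 (by rw [hω, h1, smul_zero])
  push Not at hsum
  have hp : ∀ i, ∃ p : ℂ, p ≠ 0 ∧ (X i 0)ᴴ * X i 0 = p • (1 : Matrix b b ℂ) := by
    intro i
    obtain ⟨j, k, hij, hik, hjk⟩ := hpair i
    refine ⟨(star (ω i) * ((ω i - ω j) * (ω i - ω k)))⁻¹ * (-(ω j + ω k)),
      mul_ne_zero (inv_ne_zero (hcoef i j k hij hik)) (neg_ne_zero.mpr (hsum j k hjk)), ?_⟩
    rw [mul_smul, ← hgram i j k hij hik hjk, smul_smul, inv_mul_cancel₀ (hcoef i j k hij hik),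
      one_smul]
  choose p hp0 hp using hp
  have hp' := fun i => mul_conjTranspose_eq_smul_one (hp i) (hp0 i)
  have hrow : ∀ i j, i ≠ j →
      X i 2 * (X j 2)ᴴ = (-(1 + ω i * star (ω j))) • (X i 0 * (X j 0)ᴴ) := by
    intro i j hij
    have := hr i j
    simp only [Fin.sum_univ_three, hω, if_neg hij, conjTranspose_smul, smul_mul_assoc,
      mul_smul_comm, smul_smul] at this
    rw [eq_neg_of_add_eq_zero_right this]
    module
  have hs0 : ∀ i j, i ≠ j → -(1 + ω i * star (ω j)) ≠ 0 := by
    intro i j hij h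
    apply hsum i j hij
    linear_combination -ω j * h - ω i * hω1 j
  have hC : (X 0 2)ᴴ * X 0 2 = (1 - 2 * p 0) • (1 : Matrix b b ℂ) ∧ 1 - 2 * p 0 ≠ 0 := by
    have h1 : X 0 2 * (X 0 2)ᴴ = (1 - 2 * p 0) • (1 : Matrix b b ℂ) := by
      have := hr 0 0
      simp only [Fin.sum_univ_three, hω, if_true, conjTranspose_smul, smul_mul_assoc,
        mul_smul_comm, smul_smul, hp'] at this
      have e : star (ω 0) * (ω 0 * p 0) = p 0 := by linear_combination p 0 * hω1 0
      rw [e] at this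
      rw [eq_sub_of_add_eq' this]
      module
    -- Otherwise X 0 2 = 0, and orthogonality of rows 0 and 1 would make X 0 0 (X 1 0)ᴴ zero,
    -- although both factors are invertible.
    have h0 : 1 - 2 * p 0 ≠ 0 := by
      intro h0
      rw [h0, zero_smul, self_mul_conjTranspose_eq_zero] at h1
      have h2 := hrow 0 1 (by decide)
      rw [h1, zero_mul] at h2
      have h3 := (smul_eq_zero_iff_right (hs0 0 1 (by decide))).mp h2.symm
      have h4 : ((X 0 0)ᴴ * X 0 0) * ((X 1 0)ᴴ * X 1 0) = 0 := by
        calc _ = (X 0 0)ᴴ * (X 0 0 * (X 1 0)ᴴ) * X 1 0 := by simp only [mul_assoc]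
          _ = 0 := by rw [h3, mul_zero, zero_mul]
      rw [hp, hp, smul_mul_smul_comm, one_mul, smul_eq_zero_iff_left one_ne_zero] at h4
      exact mul_ne_zero (hp0 0) (hp0 1) h4
    refine ⟨?_, h0⟩
    have := mul_conjTranspose_eq_smul_one (B := (X 0 2)ᴴ)
      (by rw [conjTranspose_conjTranspose]; exact h1) h0
    rwa [conjTranspose_conjTranspose] at this
  obtain ⟨hC, hq0⟩ := hC
  set q := 1 - 2 * p 0
  set G := (X 0 0)ᴴ * X 0 2 with hGdef
  have hG : Gᴴ * G = (p 0 * q) • (1 : Matrix b b ℂ) := by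
    calc Gᴴ * G = (X 0 2)ᴴ * (X 0 0 * (X 0 0)ᴴ) * X 0 2 := by
          simp only [G, conjTranspose_mul, conjTranspose_conjTranspose, mul_assoc]
      _ = _ := by rw [hp', mul_smul_comm, mul_one, smul_mul_assoc, hC, smul_smul]
  -- Multiply the orthogonality relation of rows i and 0 on the right by X 0 2, a multiple of a
  -- unitary.
  have hg : ∀ i, ∃ g : ℂ, g ≠ 0 ∧ X i 2 = g • (X i 0 * G) := by
    intro i
    by_cases hi : i = 0
    · refine ⟨(p 0)⁻¹, inv_ne_zero (hp0 0), ?_⟩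
      rw [hi, hGdef, ← mul_assoc, hp', smul_mul_assoc, one_mul, smul_smul,
        inv_mul_cancel₀ (hp0 0), one_smul]
    · refine ⟨q⁻¹ * (-(1 + ω i * star (ω 0))), mul_ne_zero (inv_ne_zero hq0) (hs0 i 0 hi), ?_⟩
      have h1 : q • X i 2 = (-(1 + ω i * star (ω 0))) • (X i 0 * G) := by
        calc q • X i 2 = X i 2 * (X 0 2)ᴴ * X 0 2 := by
              rw [mul_assoc, hC, mul_smul_comm, mul_one]
          _ = _ := by rw [hrow i 0 hi, hGdef, smul_mul_assoc, mul_assoc]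
      rw [mul_smul, ← h1, smul_smul, inv_mul_cancel₀ hq0, one_smul]
  choose g hg0 hg using hg
  rcases scalar_or_hasCommProducts (X := X) (B := fun i => X i 0) hW hp0
    (mul_ne_zero (hp0 0) hq0) hp hG (fun i => hXW i 0)
    (fun i => by
      have : X i 0 * G = (g i)⁻¹ • X i 2 := by
        rw [hg, smul_smul, inv_mul_cancel₀ (hg0 i), one_smul]
      rw [this]
      exact W.smul_mem _ (hXW i 2))
    (fun i k => by
      have h1 : X i 0 ∈ Submodule.span ℂ {X i 0, X i 0 * G} := Submodule.subset_span (by simp)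
      fin_cases k
      · exact h1
      · show X i 1 ∈ _
        rw [hω]
        exact Submodule.smul_mem _ _ h1
      · show X i 2 ∈ _
        rw [hg]
        exact Submodule.smul_mem _ _ (Submodule.subset_span (by simp))) with ⟨t, ht⟩ | h
  · left
    refine reducible_of_proportional (g := fun i => g i * t) hω (fun i => ?_)
      (hinj.ne (by decide))
    rw [hg, ht, mul_smul_comm, mul_one, smul_smul]
  · exact Or.inr h

end ProportionalColumns

/-! ### Equal Gram matrices and singular Hermitian matrices. -/

section EqualGram

set_option linter.unusedSectionVars false

variable {n : Type*} [Fintype n] [DecidableEq n]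

/-- Two matrices with the same Gram matrix differ by a unitary factor. -/
theorem exists_unitary_of_gram_eq {F F' : Matrix n n ℂ} (h : Fᴴ * F = F'ᴴ * F') :
    ∃ O ∈ unitaryGroup n ℂ, F' = O * F := by
  let f : EuclideanSpace ℂ n →ₗ[ℂ] EuclideanSpace ℂ n := toEuclideanLin F
  let f' : EuclideanSpace ℂ n →ₗ[ℂ] EuclideanSpace ℂ n := toEuclideanLin F'
  have hin : ∀ (M : Matrix n n ℂ) (x : EuclideanSpace ℂ n),
      inner ℂ (toEuclideanLin M x) (toEuclideanLin M x) =
        star (WithLp.ofLp x) ⬝ᵥ ((Mᴴ * M) *ᵥ WithLp.ofLp x) := by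
    intro M x
    rw [EuclideanSpace.inner_eq_star_dotProduct, dotProduct_comm, ← mulVec_mulVec,
      dotProduct_mulVec, ← star_mulVec]
    rfl
  have hnorm : ∀ x, ‖f x‖ = ‖f' x‖ := by
    intro x
    have h1 : inner ℂ (f x) (f x) = inner ℂ (f' x) (f' x) := by
      rw [hin F x, hin F' x, h]
    rw [@norm_eq_sqrt_re_inner ℂ, @norm_eq_sqrt_re_inner ℂ, h1]
  obtain ⟨s, hs⟩ := f.rangeRestrict.exists_rightInverse_of_surjective f.range_rangeRestrict
  have hfs : ∀ y, f (s y) = y := fun y => congrArg Subtype.val (LinearMap.congr_fun hs y)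
  -- The map f x ↦ f' x on the range of f, defined through a linear section; equality of norms makes
  -- it well defined and isometric.
  let L : LinearMap.range f →ₗᵢ[ℂ] EuclideanSpace ℂ n :=
    { toLinearMap := f' ∘ₗ s
      norm_map' := fun y => by
        show ‖f' (s y)‖ = ‖y‖
        rw [← hnorm, hfs]
        rfl }
  have hL : ∀ x, L.extend (f x) = f' x := by
    intro x
    have h1 : L.extend (f x) = L ⟨f x, x, rfl⟩ :=
      L.extend_apply (⟨f x, x, rfl⟩ : LinearMap.range f)
    rw [h1]
    have h2 : ‖f' (s ⟨f x, x, rfl⟩ - x)‖ = 0 := by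
      rw [← hnorm, map_sub, hfs, sub_self, norm_zero]
    rw [norm_eq_zero, map_sub, sub_eq_zero] at h2
    exact h2
  let e : EuclideanSpace ℂ n ≃ₗᵢ[ℂ] EuclideanSpace ℂ n := L.extend.toLinearIsometryEquiv rfl
  refine ⟨_, mem_unitaryGroup_of_orthonormalBasis ((EuclideanSpace.basisFun n ℂ).map e), ?_⟩
  ext r c
  have h1 := congrArg (fun v : EuclideanSpace ℂ n => v r) (hL (EuclideanSpace.single c 1))
  have h2 : f (EuclideanSpace.single c 1) = ∑ s, F s c • EuclideanSpace.single s (1 : ℂ) := by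
    ext t
    simp [f, toLpLin_apply, Finset.sum_apply, Pi.single_apply]
  have h3 : (f' (EuclideanSpace.single c 1)) r = F' r c := by
    simp [f', toLpLin_apply]
  rw [h2, map_sum] at h1
  simp only [h3] at h1
  rw [← h1, mul_apply]
  simp [e, mul_comm]

/-- A space closed under adjoints is spanned over ℂ by its Hermitian elements x + xᴴ and i(x − xᴴ).
-/
theorem exists_hermitian_pair (K : Submodule ℂ (Matrix n n ℂ)) (hK : ∀ σ ∈ K, σᴴ ∈ K)
    (h : 1 < Module.finrank ℂ K) :
    ∃ σ ∈ K, ∃ τ ∈ K, σ.IsHermitian ∧ τ.IsHermitian ∧ σ ≠ 0 ∧ ∀ a : ℂ, a • σ ≠ τ := by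
  have hdec : ∀ x : Matrix n n ℂ,
      x = (2 : ℂ)⁻¹ • ((x + xᴴ) - Complex.I • (Complex.I • (x - xᴴ))) := by
    intro x
    rw [smul_smul, Complex.I_mul_I]
    module
  have h1 : ∀ x : Matrix n n ℂ, (x + xᴴ).IsHermitian := fun x => by
    simp [IsHermitian, add_comm]
  have h2 : ∀ x : Matrix n n ℂ, (Complex.I • (x - xᴴ)).IsHermitian := fun x => by
    simp [IsHermitian, conjTranspose_smul, ← smul_neg]
  have m1 : ∀ x ∈ K, x + xᴴ ∈ K := fun x hx => K.add_mem hx (hK x hx)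
  have m2 : ∀ x ∈ K, Complex.I • (x - xᴴ) ∈ K := fun x hx =>
    K.smul_mem _ (K.sub_mem hx (hK x hx))
  have hpos : 0 < Module.finrank ℂ K := by omega
  obtain ⟨σ, hσK, hσ, hσ0⟩ : ∃ σ ∈ K, σ.IsHermitian ∧ σ ≠ 0 := by
    have := Module.finrank_pos_iff_exists_ne_zero.mp hpos
    obtain ⟨⟨x, hx⟩, hx0⟩ := this
    by_contra! hall
    apply hx0
    ext1
    show x = 0
    rw [hdec x, hall _ (m1 x hx) (h1 x), hall _ (m2 x hx) (h2 x)]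
    simp
  by_contra! hall
  have hσ' : (⟨σ, hσK⟩ : K) ≠ 0 := fun h => hσ0 (congrArg Subtype.val h)
  obtain ⟨⟨y, hy⟩, hli⟩ := exists_linearIndependent_pair_of_one_lt_finrank h hσ'
  rw [LinearIndependent.pair_iff' hσ'] at hli
  obtain ⟨a, ha⟩ := hall σ hσK _ (m1 y hy) hσ (h1 y) hσ0
  obtain ⟨c, hc⟩ := hall σ hσK _ (m2 y hy) hσ (h2 y) hσ0
  refine hli ((2 : ℂ)⁻¹ * (a - Complex.I * c)) ?_
  ext1
  show ((2 : ℂ)⁻¹ * (a - Complex.I * c)) • σ = y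
  rw [hdec y, ← ha, ← hc]
  module

/-- A self-adjoint space of `3 × 3` matrices of dimension at least two contains a nonzero singular
Hermitian matrix. -/
theorem exists_singular_hermitian (K : Submodule ℂ (Matrix (Fin 3) (Fin 3) ℂ))
    (hK : ∀ σ ∈ K, σᴴ ∈ K) (h : 1 < Module.finrank ℂ K) :
    ∃ σ ∈ K, σ.IsHermitian ∧ σ ≠ 0 ∧ σ.det = 0 := by
  obtain ⟨σ, hσK, τ, hτK, hσ, hτ, hσ0, hστ⟩ := exists_hermitian_pair K hK h
  -- The determinant along this circle is real and continuous, and it changes sign from 0 to π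
  -- because the size 3 is odd.
  let M : ℝ → Matrix (Fin 3) (Fin 3) ℂ := fun θ =>
    (Real.cos θ : ℂ) • σ + (Real.sin θ : ℂ) • τ
  have hM : ∀ θ, (M θ).IsHermitian := by
    intro θ
    simp only [M, IsHermitian, conjTranspose_add, conjTranspose_smul, hσ.eq, hτ.eq,
      Complex.star_def, Complex.conj_ofReal]
  have him : ∀ θ, (M θ).det.im = 0 := by
    intro θ
    rw [← Complex.conj_eq_iff_im, ← Complex.star_def, ← det_conjTranspose, (hM θ).eq]
  have hcont : Continuous fun θ => (M θ).det.re := by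
    refine Complex.continuous_re.comp (Continuous.matrix_det ?_)
    exact ((Complex.continuous_ofReal.comp Real.continuous_cos).smul continuous_const).add
      ((Complex.continuous_ofReal.comp Real.continuous_sin).smul continuous_const)
  have hodd : (M Real.pi).det.re = -(M 0).det.re := by
    have : M Real.pi = -M 0 := by simp [M]
    rw [this, det_neg]
    simp
    norm_num
  have hzero : (0 : ℝ) ∈ Set.range fun θ => (M θ).det.re := by
    rcases le_total (M 0).det.re 0 with h0 | h0
    · exact mem_range_of_exists_le_of_exists_ge hcont ⟨0, h0⟩ ⟨Real.pi, by rw [hodd]; linarith⟩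
    · exact mem_range_of_exists_le_of_exists_ge hcont ⟨Real.pi, by rw [hodd]; linarith⟩ ⟨0, h0⟩
  obtain ⟨θ, hθ⟩ := hzero
  refine ⟨M θ, K.add_mem (K.smul_mem _ hσK) (K.smul_mem _ hτK), hM θ, fun h0 => ?_,
    Complex.ext hθ (him θ)⟩
  by_cases hs : Real.sin θ = 0
  · have hc : (Real.cos θ : ℂ) ≠ 0 := by
      intro hc
      have := Real.sin_sq_add_cos_sq θ
      rw [hs, Complex.ofReal_eq_zero.mp hc] at this
      norm_num at this
    simp only [M, hs, Complex.ofReal_zero, zero_smul, add_zero] at h0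
    exact hσ0 ((smul_eq_zero_iff_right hc).mp h0)
  · have hs' : (Real.sin θ : ℂ) ≠ 0 := Complex.ofReal_ne_zero.mpr hs
    refine hστ (-(Real.sin θ : ℂ)⁻¹ * (Real.cos θ : ℂ)) ?_
    rw [mul_smul, eq_neg_of_add_eq_zero_left h0, smul_neg, neg_smul, neg_neg, smul_smul,
      inv_mul_cancel₀ hs', one_smul]

/-- A nonzero singular traceless Hermitian `3 × 3` matrix is `t (u uᴴ - v vᴴ)` with `u`, `v`
orthonormal. -/
theorem exists_unitary_diag_of_traceless {σ : Matrix (Fin 3) (Fin 3) ℂ} (hσ : σ.IsHermitian)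
    (h0 : σ ≠ 0) (hdet : σ.det = 0) (htr : σ.trace = 0) :
    ∃ R ∈ unitaryGroup (Fin 3) ℂ, ∃ t : ℂ, t ≠ 0 ∧
      σ = R * diagonal ![t, -t, 0] * star R := by
  have hsum : ∑ i, hσ.eigenvalues i = 0 := by
    have := hσ.trace_eq_sum_eigenvalues
    rw [htr] at this
    simp only [Complex.coe_algebraMap] at this
    exact_mod_cast this.symm
  have hprod : ∏ i, hσ.eigenvalues i = 0 := by
    have := hσ.det_eq_prod_eigenvalues
    rw [hdet] at this
    simp only [Complex.coe_algebraMap] at this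
    exact_mod_cast this.symm
  have hne : hσ.eigenvalues ≠ 0 := fun h => h0 (hσ.eigenvalues_eq_zero_iff.mp h)
  obtain ⟨l, -, hl⟩ := Finset.prod_eq_zero_iff.mp hprod
  -- Moves a zero eigenvalue to index 2; tracelessness makes the other two opposite.
  let π : Equiv.Perm (Fin 3) := Equiv.swap 2 l
  have hπ2 : hσ.eigenvalues (π 2) = 0 := by rw [Equiv.swap_apply_left]; exact hl
  have hπ : hσ.eigenvalues (π 0) + hσ.eigenvalues (π 1) = 0 := by
    rw [← Equiv.sum_comp π, Fin.sum_univ_three, hπ2, add_zero] at hsum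
    exact hsum
  have hπ0 : hσ.eigenvalues (π 0) ≠ 0 := by
    intro h
    apply hne
    have h1 : hσ.eigenvalues (π 1) = 0 := by rwa [h, zero_add] at hπ
    have h3 : ∀ i, hσ.eigenvalues (π i) = 0 := by
      intro i
      fin_cases i
      exacts [h, h1, hπ2]
    ext i
    simpa using h3 (π.symm i)
  let U : Matrix (Fin 3) (Fin 3) ℂ := hσ.eigenvectorUnitary
  have hU : U ∈ unitaryGroup (Fin 3) ℂ := hσ.eigenvectorUnitary.2
  have hspec : σ = U * diagonal (fun i => (hσ.eigenvalues i : ℂ)) * star U := by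
    have := hσ.spectral_theorem
    rw [Unitary.conjStarAlgAut_apply] at this
    exact this
  have hUπ : (U.submatrix id π) ∈ unitaryGroup (Fin 3) ℂ := by
    rw [mem_unitaryGroup_iff']
    have h1 := mem_unitaryGroup_iff'.mp hU
    ext i k
    have := congrFun (congrFun h1 (π i)) (π k)
    simpa [mul_apply, star_apply, one_apply] using this
  refine ⟨_, hUπ, (hσ.eigenvalues (π 0) : ℂ), Complex.ofReal_ne_zero.mpr hπ0, ?_⟩
  have hd : (![(hσ.eigenvalues (π 0) : ℂ), -(hσ.eigenvalues (π 0) : ℂ), 0] : Fin 3 → ℂ) =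
      fun i => (hσ.eigenvalues (π i) : ℂ) := by
    ext i
    fin_cases i
    · rfl
    · show -(hσ.eigenvalues (π 0) : ℂ) = (hσ.eigenvalues (π 1) : ℂ)
      rw [eq_neg_of_add_eq_zero_right hπ, Complex.ofReal_neg]
    · show (0 : ℂ) = (hσ.eigenvalues (π 2) : ℂ)
      rw [hπ2, Complex.ofReal_zero]
  rw [hd]
  conv_lhs => rw [hspec]
  ext i k
  rw [mul_apply, mul_apply, ← Equiv.sum_comp π]
  simp [mul_diagonal, star_apply]

end EqualGram

/-! ### Two proportional columns from Schmidt rank at most three. -/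

section SchmidtRankThree

variable {b : Type*} [Fintype b] [DecidableEq b]

/-- The coefficients in front of the products of the `A` and `B` factors satisfy a rank
inequality: either the products `(B j)ᴴ * B k` span, modulo scalars, at most a line, or the products
`(A j)ᴴ * A k` have at least two independent trace relations. -/
theorem commProducts_or_one_lt_finrank_ker [Nonempty b] {A : Fin 3 → Matrix (Fin 3) (Fin 3) ℂ}
    {B : Fin 3 → Matrix b b ℂ}
    (hrel : ∀ p q, ∑ j, ∑ k, ((A j)ᴴ * A k) p q • ((B j)ᴴ * B k) =
      if p = q then (1 : Matrix b b ℂ) else 0) :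
    CommProducts (Set.range B) ∨ ∃ K : Submodule ℂ (Matrix (Fin 3) (Fin 3) ℂ),
      1 < Module.finrank ℂ K ∧ ∀ σ, σ ∈ K ↔ ∀ j k, trace (σ * ((A j)ᴴ * A k)) = 0 := by
  obtain ⟨r₀⟩ := ‹Nonempty b›
  -- Subtracting the (r₀, r₀) entry times the identity in β kills scalar matrices, so the unitarity
  -- relations become α β = 0.
  let α : Matrix (Fin 3 × Fin 3) (Fin 3 × Fin 3) ℂ :=
    of fun pq jk => ((A jk.1)ᴴ * A jk.2) pq.1 pq.2
  let β : Matrix (Fin 3 × Fin 3) (b × b) ℂ := of fun jk rs =>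
    ((B jk.1)ᴴ * B jk.2) rs.1 rs.2 - ((B jk.1)ᴴ * B jk.2) r₀ r₀ * (1 : Matrix b b ℂ) rs.1 rs.2
  have hαβ : α * β = 0 := by
    ext ⟨p, q⟩ ⟨r, s⟩
    have h : ∀ r s, ∑ j, ∑ k, ((A j)ᴴ * A k) p q * ((B j)ᴴ * B k) r s =
        (if p = q then (1 : Matrix b b ℂ) else 0) r s := by
      intro r s
      rw [← hrel p q]
      simp [Matrix.sum_apply]
    rw [mul_apply, Fintype.sum_prod_type]
    simp only [α, β, of_apply, mul_sub, ← mul_assoc, Finset.sum_sub_distrib, ← Finset.sum_mul, h]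
    split_ifs <;> simp
  have hrank := rank_add_rank_le_card_of_mul_eq_zero hαβ
  simp only [Fintype.card_prod, Fintype.card_fin] at hrank
  by_cases hβ : β.rank ≤ 1
  · left
    rw [rank_eq_finrank_span_row, finrank_le_one_iff] at hβ
    obtain ⟨⟨v, hvmem⟩, hv⟩ := hβ
    have hform : ∀ j k, ∃ c d : ℂ, (B j)ᴴ * B k =
        c • (of fun r s => v (r, s)) + d • (1 : Matrix b b ℂ) := by
      intro j k
      obtain ⟨c, hc⟩ := hv ⟨β.row (j, k), Submodule.subset_span ⟨(j, k), rfl⟩⟩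
      refine ⟨c, ((B j)ᴴ * B k) r₀ r₀, ?_⟩
      ext r s
      have h1 := congrFun (congrArg Subtype.val hc) (r, s)
      change c * v (r, s) = ((B j)ᴴ * B k) r s -
        ((B j)ᴴ * B k) r₀ r₀ * (1 : Matrix b b ℂ) r s at h1
      simp only [Matrix.add_apply, Matrix.smul_apply, smul_eq_mul, of_apply]
      rw [h1]
      ring
    rintro _ ⟨j, rfl⟩ _ ⟨k, rfl⟩ _ ⟨l, rfl⟩ _ ⟨m, rfl⟩
    obtain ⟨c, d, h1⟩ := hform j k
    obtain ⟨c', d', h2⟩ := hform l m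
    rw [h1, h2]
    refine Commute.add_left (Commute.add_right ?_ ?_) ?_
    · exact ((Commute.refl _).smul_left _).smul_right _
    · exact (Commute.one_right _).smul_right _
    · exact (Commute.one_left _).smul_left _
  · right
    -- The transpose matches the order of indices in tr(σ M) = Σ σ(q,p) M(p,q).
    let T : Matrix (Fin 3) (Fin 3) ℂ ≃ₗ[ℂ] (Fin 3 × Fin 3 → ℂ) :=
      ((transposeLinearEquiv (Fin 3) (Fin 3) ℂ ℂ).trans (ofLinearEquiv ℂ).symm).trans
        (LinearEquiv.curry ℂ ℂ (Fin 3) (Fin 3)).symm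
    refine ⟨(LinearMap.ker αᵀ.mulVecLin).map (T.symm : _ →ₗ[ℂ] _), ?_, fun σ => ?_⟩
    · have h1 := LinearMap.finrank_range_add_finrank_ker αᵀ.mulVecLin
      have h2 : Module.finrank ℂ (LinearMap.range αᵀ.mulVecLin) = α.rank := rank_transpose α
      rw [h2, Module.finrank_fintype_fun_eq_card, Fintype.card_prod, Fintype.card_fin] at h1
      rw [LinearEquiv.finrank_map_eq]
      omega
    · rw [Submodule.mem_map_equiv, LinearEquiv.symm_symm, LinearMap.mem_ker, funext_iff, Prod.forall]
      refine forall_congr' fun j => forall_congr' fun k => ?_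
      have : αᵀ.mulVecLin (T σ) (j, k) = trace (σ * ((A j)ᴴ * A k)) := by
        rw [mulVecLin_apply, mulVec, dotProduct, Fintype.sum_prod_type, trace, Finset.sum_comm]
        simp only [diag_apply, Matrix.mul_apply (M := σ)]
        refine Finset.sum_congr rfl fun q _ => Finset.sum_congr rfl fun p _ => ?_
        exact mul_comm _ _
      exact Eq.congr this rfl

theorem scalarBlocks_mul_mul_sum {X : Matrix (Fin 3) (Fin 3) (Matrix b b ℂ)}
    {A : Fin 3 → Matrix (Fin 3) (Fin 3) ℂ} {B : Fin 3 → Matrix b b ℂ}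
    (hXA : ∀ i k, X i k = ∑ j, A j i k • B j) (P R : Matrix (Fin 3) (Fin 3) ℂ) (i k : Fin 3) :
    (scalarBlocks b P * X * scalarBlocks b R) i k = ∑ j, (P * A j * R) i k • B j := by
  rw [scalarBlocks_mul_mul_apply]
  simp only [hXA, Finset.smul_sum, smul_smul, mul_apply, Finset.sum_mul, Finset.sum_smul]
  rw [Finset.sum_congr rfl fun l _ => Finset.sum_comm, Finset.sum_comm]
  refine Finset.sum_congr rfl fun j _ => Finset.sum_congr rfl fun l _ =>
    Finset.sum_congr rfl fun m _ => ?_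
  ring_nf

/-- A relation σ = t(uuᴴ − vvᴴ) says that the families Aⱼu and Aⱼv have the same Gram matrix. The
unitary between them is diagonalized by a change of rows, with eigenvalues ωᵢ. -/
theorem hasCommProducts_or_exists_column [Nonempty b]
    {X : Matrix (Fin 3) (Fin 3) (Matrix b b ℂ)}
    (hX : X ∈ unitary (Matrix (Fin 3) (Fin 3) (Matrix b b ℂ)))
    {A : Fin 3 → Matrix (Fin 3) (Fin 3) ℂ} {B : Fin 3 → Matrix b b ℂ}
    (hXA : ∀ i k, X i k = ∑ j, A j i k • B j) :
    HasCommProducts X ∨ ∃ P ∈ unitaryGroup (Fin 3) ℂ, ∃ R ∈ unitaryGroup (Fin 3) ℂ,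
      ∃ ω : Fin 3 → ℂ, (∀ i, ω i * star (ω i) = 1) ∧
        ∀ i, (scalarBlocks b P * X * scalarBlocks b R) i 1 =
          ω i • (scalarBlocks b P * X * scalarBlocks b R) i 0 := by
  have hrel : ∀ p q, ∑ j, ∑ k, ((A j)ᴴ * A k) p q • ((B j)ᴴ * B k) =
      if p = q then (1 : Matrix b b ℂ) else 0 := by
    intro p q
    rw [← mul_apply_eq_of_isometry hX p q]
    have h : ∀ i, (X i p)ᴴ * X i q =
        ∑ j, ∑ k, (star (A j i p) * A k i q) • ((B j)ᴴ * B k) := by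
      intro i
      rw [hXA, hXA, conjTranspose_sum, Finset.sum_mul]
      refine Finset.sum_congr rfl fun j _ => ?_
      rw [Finset.mul_sum]
      refine Finset.sum_congr rfl fun k _ => ?_
      rw [conjTranspose_smul, smul_mul_smul_comm]
    symm
    rw [Finset.sum_congr rfl fun i _ => h i, Finset.sum_comm]
    refine Finset.sum_congr rfl fun j _ => ?_
    rw [Finset.sum_comm]
    refine Finset.sum_congr rfl fun k _ => ?_
    rw [← Finset.sum_smul, Matrix.mul_apply]
    rfl
  rcases commProducts_or_one_lt_finrank_ker hrel with h | ⟨K, hK, hmem⟩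
  · refine Or.inl ⟨_, h, fun i k => ?_⟩
    rw [hXA]
    exact Submodule.sum_mem _ fun j _ =>
      Submodule.smul_mem _ _ (Submodule.subset_span ⟨j, rfl⟩)
  right
  obtain ⟨σ, hσK, hσ, hσ0, hdet⟩ := exists_singular_hermitian K
    (fun σ hσ => by
      rw [hmem] at hσ ⊢
      intro j k
      have h1 : σᴴ * ((A j)ᴴ * A k) = (((A k)ᴴ * A j) * σ)ᴴ := by
        simp only [conjTranspose_mul, conjTranspose_conjTranspose]
      rw [h1, trace_conjTranspose, trace_mul_comm, hσ k j, star_zero]) hK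
  rw [hmem] at hσK
  -- Pairing σ with the unitarity relations gives tr(σ)·1 on one side and the vanishing traces tr(σ
  -- AⱼᴴAₖ) on the other.
  have htr : σ.trace = 0 := by
    have h1 : ∑ q, ∑ p, σ q p • ∑ j, ∑ k, ((A j)ᴴ * A k) p q • ((B j)ᴴ * B k) =
        σ.trace • (1 : Matrix b b ℂ) := by
      simp only [hrel, trace, diag_apply, Finset.sum_smul]
      refine Finset.sum_congr rfl fun q _ => ?_
      rw [Finset.sum_eq_single q (fun p _ hp => by rw [if_neg hp, smul_zero]) (by simp),
        if_pos rfl]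
    have h2 : ∑ q, ∑ p, σ q p • ∑ j, ∑ k, ((A j)ᴴ * A k) p q • ((B j)ᴴ * B k) =
        ∑ j, ∑ k, trace (σ * ((A j)ᴴ * A k)) • ((B j)ᴴ * B k) := by
      simp only [trace, diag_apply, Matrix.mul_apply (M := σ), Finset.sum_smul, Finset.smul_sum, smul_smul]
      rw [Finset.sum_congr rfl fun q _ => Finset.sum_comm, Finset.sum_comm]
      refine Finset.sum_congr rfl fun j _ => ?_
      rw [Finset.sum_congr rfl fun q _ => Finset.sum_comm, Finset.sum_comm]
    rw [h2] at h1
    simp only [hσK, zero_smul, Finset.sum_const_zero] at h1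
    exact (smul_eq_zero_iff_left one_ne_zero).mp h1.symm
  obtain ⟨R, hR, t, ht, hσR⟩ := exists_unitary_diag_of_traceless hσ hσ0 hdet htr
  -- Column j of `F` is Aⱼu and column j of `F'` is Aⱼv, where u and v are the first two columns of
  -- `R`.
  let F : Matrix (Fin 3) (Fin 3) ℂ := of fun i j => (A j * R) i 0
  let F' : Matrix (Fin 3) (Fin 3) ℂ := of fun i j => (A j * R) i 1
  have hgram : Fᴴ * F = F'ᴴ * F' := by
    ext j k
    have h1 := hσK j k
    have h2 : trace (σ * ((A j)ᴴ * A k)) =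
        trace (diagonal ![t, -t, 0] * ((A j * R)ᴴ * (A k * R))) := by
      rw [hσR, trace_mul_comm, ← mul_assoc, ← mul_assoc, trace_mul_comm, ← mul_assoc,
        trace_mul_comm]
      simp only [conjTranspose_mul, mul_assoc, star_eq_conjTranspose]
    rw [h2, trace, Fin.sum_univ_three] at h1
    simp only [diag_apply, diagonal_mul, cons_val_zero, cons_val_one, cons_val, zero_mul,
      add_zero] at h1
    have h3 : ((A j * R)ᴴ * (A k * R)) 0 0 = ((A j * R)ᴴ * (A k * R)) 1 1 := by
      apply mul_left_cancel₀ ht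
      linear_combination h1
    rw [mul_apply, mul_apply] at h3 ⊢
    exact h3
  obtain ⟨O, hO, hFO⟩ := exists_unitary_of_gram_eq hgram
  have hOO : Oᴴ * O = 1 := mem_unitaryGroup_iff'.mp hO
  have hOO' : O * Oᴴ = 1 := mem_unitaryGroup_iff.mp hO
  obtain ⟨S, hS, hD⟩ := exists_unitary_of_commute_normal (fun _ : Unit => O)
    (fun _ _ => Commute.refl _) (fun _ _ => hOO.trans hOO'.symm)
  obtain ⟨ω, hω⟩ := hD ()
  have hSS : Sᴴ * S = 1 := mem_unitaryGroup_iff'.mp hS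
  have hSS' : S * Sᴴ = 1 := mem_unitaryGroup_iff.mp hS
  have hdiag : Sᴴ * O * S = diagonal ω := by rw [mul_assoc, hω, ← mul_assoc, hSS, one_mul]
  have hSO : Sᴴ * O = diagonal ω * Sᴴ := by rw [← hdiag, mul_assoc _ S, hSS', mul_one]
  refine ⟨Sᴴ, Unitary.star_mem hS, R, hR, ω, fun i => ?_, fun i => ?_⟩
  · have h1 : diagonal ω * (diagonal ω)ᴴ = 1 := by
      rw [← hdiag]
      calc Sᴴ * O * S * (Sᴴ * O * S)ᴴ = Sᴴ * O * (S * Sᴴ) * Oᴴ * S := by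
            simp only [conjTranspose_mul, conjTranspose_conjTranspose, mul_assoc]
        _ = Sᴴ * (O * Oᴴ) * S := by rw [hSS', mul_one]; simp only [mul_assoc]
        _ = 1 := by rw [hOO', mul_one, hSS]
    have h2 := congrFun (congrFun h1 i) i
    rw [diagonal_conjTranspose, diagonal_mul_diagonal, diagonal_apply_eq, one_apply_eq] at h2
    exact h2
  · rw [scalarBlocks_mul_mul_sum hXA, scalarBlocks_mul_mul_sum hXA, Finset.smul_sum]
    refine Finset.sum_congr rfl fun j _ => ?_
    rw [smul_smul]
    congr 1
    have h1 : Sᴴ * F' = diagonal ω * (Sᴴ * F) := by rw [hFO, ← mul_assoc, hSO, mul_assoc]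
    have h2 := congrFun (congrFun h1 i) j
    rw [diagonal_mul, mul_apply, mul_apply] at h2
    rw [mul_assoc, mul_apply, mul_apply]
    exact h2

theorem hasCommProducts_or_blockDiagonalizable {X : Matrix (Fin 3) (Fin 3) (Matrix b b ℂ)}
    (hX : X ∈ unitary (Matrix (Fin 3) (Fin 3) (Matrix b b ℂ)))
    {A : Fin 3 → Matrix (Fin 3) (Fin 3) ℂ} {B : Fin 3 → Matrix b b ℂ}
    (hXA : ∀ i k, X i k = ∑ j, A j i k • B j) :
    HasCommProducts X ∨ BlockDiagonalizable X := by
  -- For d_B = 0 all blocks coincide; otherwise 1 ≠ 0, as cancelling scalar multiples of the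
  -- identity requires.
  cases isEmpty_or_nonempty b
  · exact Or.inl ⟨Set.univ, fun _ _ _ _ _ _ _ _ => Subsingleton.elim _ _,
      fun i k => Submodule.subset_span (Set.mem_univ _)⟩
  rcases hasCommProducts_or_exists_column hX hXA with h | ⟨P, hP, R, hR, ω, hω1, hω⟩
  · exact Or.inl h
  let W : Submodule ℂ (Matrix b b ℂ) := Submodule.span ℂ (Set.range B)
  have hW : Module.finrank ℂ W ≤ 3 := (finrank_range_le_card B).trans (by simp)
  have hXW : ∀ i k, X i k ∈ W := fun i k => by
    rw [hXA]
    exact W.sum_mem fun j _ => W.smul_mem _ (Submodule.subset_span ⟨j, rfl⟩)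
  have hYW := fun i k => scalarBlocks_mul_mul_mem (P := P) (R := R) hXW i k
  have hYu : scalarBlocks b P * X * scalarBlocks b R ∈
      unitary (Matrix (Fin 3) (Fin 3) (Matrix b b ℂ)) :=
    mul_mem (mul_mem (scalarBlocks_mem_unitary hP) hX) (scalarBlocks_mem_unitary hR)
  refine Or.imp (HasCommProducts.of_conj hP hR) (BlockDiagonalizable.of_conj hP hR) ?_
  rcases reducible_or_hasCommProducts_of_column hYu hW hYW hω1 hω with h | h
  · exact h.hasCommProducts_or_blockDiagonalizable hYu hW hYW
  · exact Or.inl h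

end SchmidtRankThree

end BipartiteUnitary

theorem theorem3p4 (dB : ℕ) (U : Matrix (Fin 3 × Fin dB) (Fin 3 × Fin dB) ℂ)
    (hU : U ∈ Matrix.unitaryGroup (Fin 3 × Fin dB) ℂ)
    (hrank : BipartiteUnitary.HasSchmidtRank U 3) :
    BipartiteUnitary.IsControlledFromA U ∨ BipartiteUnitary.IsControlledFromB U := by
  obtain ⟨A, B, -, -, hUAB⟩ := hrank
  obtain ⟨X, rfl⟩ := (Matrix.comp (Fin 3) (Fin 3) (Fin dB) (Fin dB) ℂ).surjective U
  rw [BipartiteUnitary.comp_mem_unitary_iff] at hU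
  have hXA : ∀ i k, X i k = ∑ j, A j i k • B j := by
    intro i k
    ext r s
    have := congrFun (congrFun hUAB (i, r)) (k, s)
    simpa [Matrix.comp_apply, Matrix.sum_apply, Matrix.kroneckerMap_apply] using this
  rcases BipartiteUnitary.hasCommProducts_or_blockDiagonalizable hU hXA with h | h
  · exact Or.inr (BipartiteUnitary.isControlledFromB_of_hasCommProducts hU h)
  · exact Or.inl (BipartiteUnitary.isControlledFromA_of_blockDiagonalizable hU h)
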